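/- Let $\mathbf D^3=\{x\in\mathbf R^3:|x|<1\}$ be the ball model of $\mathbf H^3$, with boundary at infinity $\mathbf S^2=\partial\mathbf D^3$, and let $V=\mathbf R\times\mathbf D^3$ be 4-dimensional anti-de Sitter space, with the Lorentzian metric $$ds^2=-\Big(\frac{1+|x|^2}{1-|x|^2}\Big)^2dt^2+\frac{4}{(1-|x|^2)^2}\,(dx_1^2+dx_2^2+dx_3^2).$$ A slice of $V$ is a smooth spacelike hypersurface $M_u=\{(u(x),x):x\in\mathbf D^3\}$, the graph of a smooth height function $u:\mathbf D^3\to\mathbf R$. It is maximal if its mean curvature in $V$ vanishes identically, and totally geodesic if its second fundamental form in $V$ vanishes identically. (1) Let $M=M_u$ be a maximal slice whose height function $u$ extends continuously to $\mathbf D^3\cup\mathbf S^2$, with boundary value $w$ on $\mathbf S^2$; write $w(\theta,\phi)$ for its value at $(\sin\theta\cos\phi,\sin\theta\sin\phi,\cos\theta)$. Then $M$ is totally geodesic if and only if there are real constants $w_0,A,B,C$ with $A^2+B^2+C^2<1$ such that, for all $\theta,\phi$, $$\cos\big(w(\theta,\phi)+w_0\big)=A\sin\theta\cos\phi+B\sin\theta\sin\phi+C\cos\theta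 .$$ (2) Let $\langle X,Y\rangle=X_1Y_1+X_2Y_2+X_3Y_3-X_4Y_4-X_5Y_5$ on $\mathbf R^5$, let $Q=\{X\in\mathbf R^5:\langle X,X\rangle=-1\}$, and let $\Phi:V\to Q$ be the map $$\Phi(t,x)=\Big(\frac{2x_1}{1-|x|^2},\frac{2x_2}{1-|x|^2},\frac{2x_3}{1-|x|^2},\frac{1+|x|^2}{1-|x|^2}\cos t,\frac{1+|x|^2}{1-|x|^2}\sin t\Big).$$ Then the images $\Phi(M)$ of the totally geodesic maximal slices $M$ whose height function extends continuously to $\mathbf D^3\cup\mathbf S^2$ are exactly the connected components of the hyperplane sections $Q\cap\{X\in\mathbf R^5:\langle X,a\rangle=0\}$, where $a\in\mathbf R^5$ with $\langle a,a\rangle<0$. -/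

import Mathlib

open Filter Topology
open scoped ContDiff Matrix

namespace AdS

noncomputable section

/-- The `i`-th partial derivative at `p` of a function of `n` real variables. -/
def pd {n : ℕ} (f : (Fin n → ℝ) → ℝ) (i : Fin n) (p : Fin n → ℝ) : ℝ :=
  fderiv ℝ f p (Pi.single i 1)

/-- The squared Euclidean norm on `ℝ³`. -/
def normSq (x : Fin 3 → ℝ) : ℝ := ∑ i, x i ^ 2

/-- The open Euclidean unit ball of `ℝ³`, the underlying set of the ball model of `H³`. -/
def ball : Set (Fin 3 → ℝ) := {x | normSq x < 1}

/-- The Euclidean unit sphere `S²`, the boundary at infinity of `H³`. -/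
def sphere : Set (Fin 3 → ℝ) := {x | normSq x = 1}

/-! ### Anti-de Sitter space

Anti-de Sitter space is `ℝ × H³` with global coordinates `p = (t, x₁, x₂, x₃)`, `x` in the unit
ball, and the warped product metric
`-((1 + |x|²) / (1 - |x|²))² dt² + 4 / (1 - |x|²)² (dx₁² + dx₂² + dx₃²)`. -/

/-- The matrix of the anti-de Sitter metric at `p = (t, x)`. -/
def metric (p : Fin 4 → ℝ) : Matrix (Fin 4) (Fin 4) ℝ :=
  Matrix.diagonal (Fin.cons (-((1 + normSq (Fin.tail p)) / (1 - normSq (Fin.tail p))) ^ 2)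
    (fun _ => 4 / (1 - normSq (Fin.tail p)) ^ 2))

/-- The scalar product of two tangent vectors at `p`. -/
def metricAt (p v w : Fin 4 → ℝ) : ℝ := v ⬝ᵥ (metric p *ᵥ w)

/-- The Christoffel symbols `Γᵏᵢⱼ` of the Levi-Civita connection of the anti-de Sitter metric. -/
def christoffel (p : Fin 4 → ℝ) (k i j : Fin 4) : ℝ :=
  1 / 2 * ∑ l, (metric p)⁻¹ k l *
    (pd (fun q => metric q j l) i p + pd (fun q => metric q i l) j p
      - pd (fun q => metric q i j) l p)

/-! ### Slices

A slice is the graph `{(u x, x) | x ∈ H³}` of a height function `u` on `H³`. -/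

/-- The graph map `x ↦ (u x, x)`. -/
def embed (u : (Fin 3 → ℝ) → ℝ) (x : Fin 3 → ℝ) : Fin 4 → ℝ := Fin.cons (u x) x

/-- The graph of `u` over `H³`, as a subset of anti-de Sitter space. -/
def slice (u : (Fin 3 → ℝ) → ℝ) : Set (Fin 4 → ℝ) := embed u '' ball

/-- The coordinate tangent vector `∂ᵢ` of the graph of `u` at the point over `x`. -/
def tangent (u : (Fin 3 → ℝ) → ℝ) (i : Fin 3) (x : Fin 3 → ℝ) : Fin 4 → ℝ :=
  fun k => pd (fun y => embed u y k) i x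

/-- The induced metric on the graph of `u`. -/
def inducedMetric (u : (Fin 3 → ℝ) → ℝ) (x : Fin 3 → ℝ) : Matrix (Fin 3) (Fin 3) ℝ :=
  Matrix.of fun i j => metricAt (embed u x) (tangent u i x) (tangent u j x)

/-- The gradient, with respect to the anti-de Sitter metric, of the function `(t, x) ↦ t - u x`,
whose zero set is the graph of `u`, at the point of the graph over `x`. -/
def gradDefining (u : (Fin 3 → ℝ) → ℝ) (x : Fin 3 → ℝ) : Fin 4 → ℝ :=
  (metric (embed u x))⁻¹ *ᵥ Fin.cons 1 (fun i => -pd u i x)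

/-- The future-directed (`dt > 0`) timelike unit normal of a spacelike graph. -/
def normal (u : (Fin 3 → ℝ) → ℝ) (x : Fin 3 → ℝ) : Fin 4 → ℝ :=
  (-(1 / √(-metricAt (embed u x) (gradDefining u x) (gradDefining u x)))) • gradDefining u x

/-- The covariant derivative in anti-de Sitter space of the tangent field `∂ⱼ` of the graph of `u`
in the direction of `∂ᵢ`. -/
def covDeriv (u : (Fin 3 → ℝ) → ℝ) (x : Fin 3 → ℝ) (i j : Fin 3) : Fin 4 → ℝ :=
  fun k => pd (fun y => tangent u j y k) i x +
    ∑ a, ∑ b, christoffel (embed u x) k a b * tangent u i x a * tangent u j x b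

/-- The second fundamental form `hᵢⱼ = ⟨∇ᵢ N, ∂ⱼ⟩ = -⟨∇ᵢ ∂ⱼ, N⟩` of the graph of `u`. -/
def secondFundamentalForm (u : (Fin 3 → ℝ) → ℝ) (x : Fin 3 → ℝ) : Matrix (Fin 3) (Fin 3) ℝ :=
  Matrix.of fun i j => -metricAt (embed u x) (covDeriv u x i j) (normal u x)

/-- The mean curvature of the graph of `u`: the trace of the second fundamental form with respect
to the induced metric. -/
def meanCurvature (u : (Fin 3 → ℝ) → ℝ) (x : Fin 3 → ℝ) : ℝ :=
  ((inducedMetric u x)⁻¹ * secondFundamentalForm u x).trace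

/-- The graph of `u` is a smooth spacelike hypersurface: `u` is smooth on `H³` and the induced
metric is Riemannian. -/
structure IsSlice (u : (Fin 3 → ℝ) → ℝ) : Prop where
  smooth : ContDiffOn ℝ ∞ u ball
  spacelike : ∀ x ∈ ball, (inducedMetric u x).PosDef

/-- A maximal slice: a slice of vanishing mean curvature. -/
structure IsMaximalSlice (u : (Fin 3 → ℝ) → ℝ) : Prop extends IsSlice u where
  meanCurvature_eq_zero : ∀ x ∈ ball, meanCurvature u x = 0

/-- The graph of `u` is totally geodesic: its second fundamental form vanishes. -/
def IsTotallyGeodesic (u : (Fin 3 → ℝ) → ℝ) : Prop :=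
  ∀ x ∈ ball, secondFundamentalForm u x = 0

/-- `u` extends continuously to the boundary at infinity `S²`, where the extension equals `w`.
Only the values of `w` on the sphere matter. -/
def HasBoundaryValue (u w : (Fin 3 → ℝ) → ℝ) : Prop :=
  ∀ p ∈ sphere, Tendsto u (𝓝[ball] p) (𝓝 (w p))

/-- The point of `S²` with polar angle `θ` and azimuth `φ`. -/
def spherePoint (θ φ : ℝ) : Fin 3 → ℝ :=
  ![Real.sin θ * Real.cos φ, Real.sin θ * Real.sin φ, Real.cos θ]

/-! ### The quadric model -/

/-- The scalar product of signature `(3, 2)` on `ℝ⁵`. -/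
def form (X Y : Fin 5 → ℝ) : ℝ :=
  X 0 * Y 0 + X 1 * Y 1 + X 2 * Y 2 - X 3 * Y 3 - X 4 * Y 4

/-- The quadric `⟨X, X⟩ = -1`. -/
def quadric : Set (Fin 5 → ℝ) := {X | form X X = -1}

/-- The linear hyperplane orthogonal to `a`. -/
def hyperplane (a : Fin 5 → ℝ) : Set (Fin 5 → ℝ) := {X | form X a = 0}

/-- The coordinate map `(t, x) ↦ X` onto the quadric; it is `2π`-periodic in `t`. -/
def toQuadric (p : Fin 4 → ℝ) : Fin 5 → ℝ :=
  ![2 * p 1 / (1 - normSq (Fin.tail p)),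
    2 * p 2 / (1 - normSq (Fin.tail p)),
    2 * p 3 / (1 - normSq (Fin.tail p)),
    (1 + normSq (Fin.tail p)) / (1 - normSq (Fin.tail p)) * Real.cos (p 0),
    (1 + normSq (Fin.tail p)) / (1 - normSq (Fin.tail p)) * Real.sin (p 0)]

end

end AdS

/-!
Anti-de Sitter space is, up to a covering in the time direction, the quadric `⟨X, X⟩ = -1` of `ℝ⁵`,
and everything follows from studying the linear functions `⟨·, a⟩` along a slice. Write `f` for the
restriction of such a function to the graph of `u` (`pairing`). The Gauss formula
(`hasPd_pairingDeriv`) expresses its second partial derivatives as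
`∂ᵢ∂ⱼ f = ∑ₖ cᵏᵢⱼ ∂ₖ f + Bᵢⱼ τ + gᵢⱼ f`, where `g` is the induced metric, `τ` is the pairing of
`∂/∂t` with `a`, and `B` is the second fundamental form up to a positive factor.

* If `f = 0` on the slice for a timelike `a`, then `B τ = 0`, while `τ` cannot vanish
  (`cross_ne_zero`), so the slice is totally geodesic (`isTotallyGeodesic_of_pairing_eq_zero`).
* If the slice is totally geodesic, take for `a` its normal vector at the centre of the ball. The
  1-jet of `f` vanishes there, and with `B = 0` the Gauss formula is a linear ordinary differential
  equation along rays, so `f = 0` everywhere (`IsTotallyGeodesic.exists_pairing_eq_zero`). In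
  coordinates `f = 0` reads `cos (u + w₀) = (A x₁ + B x₂ + C x₃) · 2 / (1 + |x|²)`, and the limit at
  the sphere is the asserted equation.
* Conversely, suppose that a maximal slice has boundary values satisfying that equation. The trace
  of the Gauss formula is `Δ f = 3 f`, so no `f` has a positive interior maximum
  (`pairing_nonpos_of_isLocalMax`), and `f ≤ 0` follows from negative boundary values
  (`pairing_nonpos`). For the vector `a` given by the equation, the boundary values of the rescaled
  `f` vanish. Since `A² + B² + C² < 1`, the function `sin (w + w₀)` has no zero on the sphere, which
  is connected, so one of `± sin (w + w₀)` is positive there. It gives a second linear function with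
  negative boundary values. Adding small multiples of it to `± f` yields `f = 0`
  (`exists_pairing_eq_zero_of_boundary`).

For the hyperplane sections, `X₄ a₅ - X₅ a₄` has no zero on the section by `a^⊥`, with `a` timelike,
and its sign tells the two sides apart. A point of the section is determined by its projection to
the ball and its side, so an entire graph inside the section is a full component
(`image_slice_eq_connectedComponentIn`). Both sides are graphs, written down with `arccos`
(`exists_isMaximalSlice`).
-/

namespace AdS

/-! ### Partial derivatives -/

/-- The function `f` is differentiable at `p` and its `i`-th partial derivative there is `v`. -/
def HasPd {n : ℕ} (f : (Fin n → ℝ) → ℝ) (i : Fin n) (p : Fin n → ℝ) (v : ℝ) : Prop :=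
  DifferentiableAt ℝ f p ∧ pd f i p = v

section Calculus

variable {n : ℕ} {f g : (Fin n → ℝ) → ℝ} {i : Fin n} {p : Fin n → ℝ} {v w : ℝ}

lemma HasPd.eq (h : HasPd f i p v) : pd f i p = v := h.2

lemma HasPd.congr_value (h : HasPd f i p v) (e : v = w) : HasPd f i p w := e ▸ h

lemma hasPd_of_differentiableAt (h : DifferentiableAt ℝ f p) (i : Fin n) :
    HasPd f i p (pd f i p) := ⟨h, rfl⟩

lemma hasPd_of_hasFDerivAt {f' : (Fin n → ℝ) →L[ℝ] ℝ} (h : HasFDerivAt f f' p) (i : Fin n) :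
    HasPd f i p (f' (Pi.single i 1)) :=
  ⟨h.differentiableAt, by rw [pd, h.fderiv]⟩

lemma hasPd_const (c : ℝ) : HasPd (fun _ => c) i p 0 :=
  (hasPd_of_hasFDerivAt (hasFDerivAt_const c p) i).congr_value (by simp)

lemma hasPd_coord (k : Fin n) : HasPd (fun q => q k) i p (if k = i then 1 else 0) :=
  (hasPd_of_hasFDerivAt (hasFDerivAt_apply k p) i).congr_value (by simp [Pi.single_apply])

lemma HasPd.add (hf : HasPd f i p v) (hg : HasPd g i p w) :
    HasPd (fun q => f q + g q) i p (v + w) :=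
  ⟨hf.1.add hg.1, by rw [← hf.2, ← hg.2, pd, pd, pd, fderiv_fun_add hf.1 hg.1]; rfl⟩

lemma HasPd.neg (hf : HasPd f i p v) : HasPd (fun q => -f q) i p (-v) :=
  ⟨hf.1.neg, by rw [← hf.2, pd, pd, fderiv_fun_neg]; rfl⟩

lemma HasPd.sub (hf : HasPd f i p v) (hg : HasPd g i p w) :
    HasPd (fun q => f q - g q) i p (v - w) :=
  ⟨hf.1.sub hg.1, by rw [← hf.2, ← hg.2, pd, pd, pd, fderiv_fun_sub hf.1 hg.1]; rfl⟩

lemma HasPd.mul (hf : HasPd f i p v) (hg : HasPd g i p w) :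
    HasPd (fun q => f q * g q) i p (f p * w + g p * v) :=
  ⟨hf.1.mul hg.1, by
    rw [← hf.2, ← hg.2, pd, pd, pd, fderiv_fun_mul hf.1 hg.1]
    simp⟩

/-- The chain rule for a function of one real variable. -/
lemma HasPd.comp {φ : ℝ → ℝ} {φ' : ℝ} (hφ : HasDerivAt φ φ' (f p)) (hf : HasPd f i p v) :
    HasPd (fun q => φ (f q)) i p (φ' * v) := by
  have h := hφ.comp_hasFDerivAt p hf.1.hasFDerivAt
  refine (hasPd_of_hasFDerivAt h i).congr_value ?_
  rw [← hf.2, pd]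
  simp

lemma HasPd.div (hf : HasPd f i p v) (hg : HasPd g i p w) (h0 : g p ≠ 0) :
    HasPd (fun q => f q / g q) i p ((v * g p - f p * w) / g p ^ 2) := by
  have h := hf.mul (hg.comp (hasDerivAt_inv h0))
  refine HasPd.congr_value (by simpa only [div_eq_mul_inv] using h) ?_
  field_simp
  ring

lemma HasPd.pow (hf : HasPd f i p v) (k : ℕ) :
    HasPd (fun q => f q ^ k) i p (k * f p ^ (k - 1) * v) :=
  hf.comp (hasDerivAt_pow k (f p))

lemma HasPd.cos (hf : HasPd f i p v) :
    HasPd (fun q => Real.cos (f q)) i p (-Real.sin (f p) * v) :=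
  hf.comp (Real.hasDerivAt_cos _)

lemma HasPd.sin (hf : HasPd f i p v) :
    HasPd (fun q => Real.sin (f q)) i p (Real.cos (f p) * v) :=
  hf.comp (Real.hasDerivAt_sin _)

lemma HasPd.sum {m : ℕ} {F : Fin m → (Fin n → ℝ) → ℝ} {V : Fin m → ℝ}
    (h : ∀ k, HasPd (F k) i p (V k)) : HasPd (fun q => ∑ k, F k q) i p (∑ k, V k) :=
  ⟨DifferentiableAt.fun_sum fun k _ => (h k).1, by
    rw [pd, fderiv_fun_sum fun k _ => (h k).1, sum_apply]
    exact Finset.sum_congr rfl fun k _ => (h k).2⟩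

lemma HasPd.congr_of_eventuallyEq (hf : HasPd f i p v) (h : g =ᶠ[𝓝 p] f) : HasPd g i p v :=
  ⟨hf.1.congr_of_eventuallyEq h, by rw [← hf.2, pd, pd, h.fderiv_eq]⟩

lemma pd_congr (h : f =ᶠ[𝓝 p] g) : pd f i p = pd g i p := by rw [pd, pd, h.fderiv_eq]

/-- A directional derivative is the combination of the partial derivatives. -/
lemma fderiv_apply_eq_sum (f : (Fin n → ℝ) → ℝ) (p y : Fin n → ℝ) :
    fderiv ℝ f p y = ∑ i, y i * pd f i p := by
  conv_lhs => rw [pi_eq_sum_univ' y]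
  simp [map_sum, pd]

/-- The derivative of a function along an affine line. -/
lemma hasDerivAt_line (y z : Fin n → ℝ) (s : ℝ) (hf : DifferentiableAt ℝ f (y + s • z)) :
    HasDerivAt (fun t : ℝ => f (y + t • z)) (∑ i, z i * pd f i (y + s • z)) s := by
  rw [← fderiv_apply_eq_sum]
  have h1 : HasDerivAt (fun t : ℝ => y + t • z) z s := by
    simpa using ((hasDerivAt_id s).smul_const z).const_add y
  exact hf.hasFDerivAt.comp_hasDerivAt s h1

lemma contDiffAt_pd (hf : ContDiffAt ℝ ∞ f p) (i : Fin n) : ContDiffAt ℝ ∞ (pd f i) p :=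
  (hf.fderiv_right (m := ∞) (by simp)).clm_apply contDiffAt_const

end Calculus

/-! ### The ball -/

lemma normSq_nonneg (x : Fin 3 → ℝ) : 0 ≤ normSq x := Finset.sum_nonneg fun _ _ => sq_nonneg _

lemma contDiff_normSq : ContDiff ℝ ∞ normSq := by
  unfold normSq
  fun_prop

lemma isOpen_ball : IsOpen ball := isOpen_lt contDiff_normSq.continuous continuous_const

lemma one_sub_normSq_pos {x : Fin 3 → ℝ} (hx : x ∈ ball) : 0 < 1 - normSq x := sub_pos.2 hx

lemma one_add_normSq_pos (x : Fin 3 → ℝ) : 0 < 1 + normSq x := by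
  have := normSq_nonneg x
  linarith

lemma hasPd_normSq (x : Fin 3 → ℝ) (i : Fin 3) : HasPd normSq i x (2 * x i) := by
  have h : HasPd (fun q : Fin 3 → ℝ => ∑ k, q k ^ 2) i x _ :=
    HasPd.sum fun k => (hasPd_coord k).pow 2
  refine h.congr_value ?_
  simp

/-- The lapse `(1 + |x|²) / (1 - |x|²)` of the static anti-de Sitter metric. -/
noncomputable def lapse (x : Fin 3 → ℝ) : ℝ := (1 + normSq x) / (1 - normSq x)

/-- The conformal factor `2 / (1 - |x|²)` of the ball model of hyperbolic space. -/
noncomputable def conf (x : Fin 3 → ℝ) : ℝ := 2 / (1 - normSq x)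

lemma lapse_pos {x : Fin 3 → ℝ} (hx : x ∈ ball) : 0 < lapse x :=
  div_pos (one_add_normSq_pos x) (one_sub_normSq_pos hx)

lemma conf_pos {x : Fin 3 → ℝ} (hx : x ∈ ball) : 0 < conf x :=
  div_pos two_pos (one_sub_normSq_pos hx)

lemma hasPd_conf {x : Fin 3 → ℝ} (hx : x ∈ ball) (i : Fin 3) :
    HasPd conf i x (conf x ^ 2 * x i) := by
  have h1 := (one_sub_normSq_pos hx).ne'
  refine HasPd.congr_value
    ((hasPd_const 2).div ((hasPd_const 1).sub (hasPd_normSq x i)) h1) ?_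
  rw [conf]
  field_simp
  ring

lemma lapse_eq {x : Fin 3 → ℝ} (hx : x ∈ ball) : lapse x = conf x - 1 := by
  have h1 := (one_sub_normSq_pos hx).ne'
  rw [lapse, conf]
  field_simp
  ring

lemma hasPd_lapse {x : Fin 3 → ℝ} (hx : x ∈ ball) (i : Fin 3) :
    HasPd lapse i x (conf x ^ 2 * x i) := by
  refine HasPd.congr_of_eventuallyEq (((hasPd_conf hx i).sub (hasPd_const 1)).congr_value
    (sub_zero _)) ?_
  filter_upwards [isOpen_ball.mem_nhds hx] with y hy using lapse_eq hy

lemma zero_mem_ball : (0 : Fin 3 → ℝ) ∈ ball := by simp [ball, normSq]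

lemma smul_mem_ball {x : Fin 3 → ℝ} (hx : x ∈ ball) {s : ℝ} (h0 : 0 ≤ s) (h1 : s ≤ 1) :
    s • x ∈ ball := by
  have : normSq (s • x) = s ^ 2 * normSq x := by simp [normSq, mul_pow, Finset.mul_sum]
  have hx' : normSq x < 1 := hx
  have := normSq_nonneg x
  change normSq (s • x) < 1
  nlinarith [mul_le_mul_of_nonneg_right (pow_le_one₀ h0 h1 : s ^ 2 ≤ 1) this]

lemma isPreconnected_ball : IsPreconnected ball := by
  have h : StarConvex ℝ 0 ball := fun y hy a b ha hb hab => by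
    simpa using smul_mem_ball hy hb (by linarith)
  exact (h.isPathConnected zero_mem_ball).isConnected.isPreconnected

/-! ### The Levi-Civita connection -/

/-- The diagonal entries of the anti-de Sitter metric. -/
noncomputable def metricDiag (k : Fin 4) (p : Fin 4 → ℝ) : ℝ :=
  (Fin.cons (-((1 + normSq (Fin.tail p)) / (1 - normSq (Fin.tail p))) ^ 2)
    (fun _ => 4 / (1 - normSq (Fin.tail p)) ^ 2) : Fin 4 → ℝ) k

lemma metricDiag_zero (p : Fin 4 → ℝ) : metricDiag 0 p = -lapse (Fin.tail p) ^ 2 := rfl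

lemma metricDiag_succ (k : Fin 3) (p : Fin 4 → ℝ) :
    metricDiag k.succ p = conf (Fin.tail p) ^ 2 := by
  rw [conf, div_pow]
  norm_num [metricDiag]

lemma metric_eq (p : Fin 4 → ℝ) : metric p = Matrix.diagonal (fun k => metricDiag k p) := rfl

lemma metricDiag_ne_zero {p : Fin 4 → ℝ} (hp : Fin.tail p ∈ ball) (k : Fin 4) :
    metricDiag k p ≠ 0 := by
  refine Fin.cases ?_ (fun k => ?_) k
  · rw [metricDiag_zero]
    exact neg_ne_zero.2 (pow_ne_zero 2 (lapse_pos hp).ne')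
  · rw [metricDiag_succ]
    exact pow_ne_zero 2 (conf_pos hp).ne'

lemma metric_inv {p : Fin 4 → ℝ} (hp : Fin.tail p ∈ ball) :
    (metric p)⁻¹ = Matrix.diagonal (fun k => (metricDiag k p)⁻¹) := by
  refine Matrix.inv_eq_right_inv ?_
  rw [metric_eq, Matrix.diagonal_mul_diagonal, ← Matrix.diagonal_one]
  congr 1
  funext k
  exact mul_inv_cancel₀ (metricDiag_ne_zero hp k)

/-- A function of the space coordinates, as a function on space-time, has the same space
derivatives and no time derivative. -/
lemma HasPd.comp_tail {f : (Fin 3 → ℝ) → ℝ} {p : Fin 4 → ℝ} {v : Fin 3 → ℝ}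
    (h : ∀ i, HasPd f i (Fin.tail p) (v i)) (i : Fin 4) :
    HasPd (fun q : Fin 4 → ℝ => f (Fin.tail q)) i p ((Fin.cons 0 v : Fin 4 → ℝ) i) := by
  have hT : HasFDerivAt (fun q : Fin 4 → ℝ => (Fin.tail q : Fin 3 → ℝ))
      (ContinuousLinearMap.pi fun k : Fin 3 => ContinuousLinearMap.proj (R := ℝ) k.succ) p :=
    hasFDerivAt_pi.2 fun k => hasFDerivAt_apply k.succ p
  have hc := (h 0).1.hasFDerivAt.comp p hT
  refine (hasPd_of_hasFDerivAt hc i).congr_value ?_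
  rw [ContinuousLinearMap.comp_apply, fderiv_apply_eq_sum]
  refine Fin.cases ?_ (fun k => ?_) i
  · simp
  · simp [Pi.single_apply, (h k).2]

lemma hasPd_metricDiag_zero {p : Fin 4 → ℝ} (hp : Fin.tail p ∈ ball) (i : Fin 4) :
    HasPd (metricDiag 0) i p ((Fin.cons 0 (fun i => -(2 * lapse (Fin.tail p) *
      (conf (Fin.tail p) ^ 2 * Fin.tail p i))) : Fin 4 → ℝ) i) :=
  HasPd.comp_tail (fun i => ((hasPd_lapse hp i).pow 2).neg.congr_value (by simp)) i

lemma hasPd_metricDiag_succ {p : Fin 4 → ℝ} (hp : Fin.tail p ∈ ball) (k : Fin 3) (i : Fin 4) :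
    HasPd (metricDiag k.succ) i p ((Fin.cons 0 (fun i => 2 * conf (Fin.tail p) *
      (conf (Fin.tail p) ^ 2 * Fin.tail p i)) : Fin 4 → ℝ) i) := by
  have := HasPd.comp_tail (fun i => ((hasPd_conf hp i).pow 2).congr_value
    (by simp : _ = 2 * conf (Fin.tail p) * (conf (Fin.tail p) ^ 2 * Fin.tail p i))) i
  refine this.congr_of_eventuallyEq (Eventually.of_forall fun q => ?_)
  exact metricDiag_succ k q

lemma christoffel_eq {p : Fin 4 → ℝ} (hp : Fin.tail p ∈ ball) (k i j : Fin 4) :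
    christoffel p k i j = 1 / 2 * ((metricDiag k p)⁻¹ *
      ((if j = k then pd (metricDiag j) i p else 0) +
       (if i = k then pd (metricDiag i) j p else 0) -
       (if i = j then pd (metricDiag i) k p else 0))) := by
  have key : ∀ i j k : Fin 4, pd (fun q => metric q i j) k p =
      if i = j then pd (metricDiag i) k p else 0 := by
    intro i j k
    by_cases h : i = j
    · subst h
      simp only [metric_eq, Matrix.diagonal_apply_eq, if_true]
    · simp only [metric_eq, Matrix.diagonal_apply_ne _ h, if_neg h]
      exact (hasPd_const 0).eq
  rw [christoffel, metric_inv hp, Finset.sum_eq_single k]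
  · rw [Matrix.diagonal_apply_eq, key, key, key]
  · intro l _ hl
    rw [Matrix.diagonal_apply_ne _ hl.symm, zero_mul]
  · simp

/-- The value of a Christoffel symbol on a pair of vectors. -/
lemma sum_christoffel {p : Fin 4 → ℝ} (hp : Fin.tail p ∈ ball) (k : Fin 4) (v w : Fin 4 → ℝ) :
    ∑ a, ∑ b, christoffel p k a b * v a * w b = 1 / 2 * ((metricDiag k p)⁻¹ *
      ((∑ a, pd (metricDiag k) a p * v a) * w k + (∑ b, pd (metricDiag k) b p * w b) * v k -
        ∑ a, pd (metricDiag a) k p * v a * w a)) := by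
  have h : ∀ a b, christoffel p k a b * v a * w b = 1 / 2 * (metricDiag k p)⁻¹ *
      ((if b = k then pd (metricDiag b) a p * v a * w b else 0) +
       (if a = k then pd (metricDiag a) b p * v a * w b else 0) -
       (if a = b then pd (metricDiag a) k p * v a * w b else 0)) := by
    intro a b
    rw [christoffel_eq hp]
    split_ifs <;> ring
  simp only [h, ← Finset.mul_sum, Finset.sum_add_distrib, Finset.sum_sub_distrib]
  simp only [Finset.sum_ite_eq', Finset.sum_ite_eq, Finset.mem_univ, if_true]
  rw [Finset.sum_comm (f := fun a b => if a = k then pd (metricDiag a) b p * v a * w b else 0)]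
  simp only [Finset.sum_ite_eq', Finset.mem_univ, if_true]
  rw [mul_assoc, Finset.sum_mul, Finset.sum_mul]
  congr 4
  exact Finset.sum_congr rfl fun b _ => by ring

/-! ### The geometry of a graph -/

section Graph

variable {u : (Fin 3 → ℝ) → ℝ} {x : Fin 3 → ℝ}

lemma tail_embed (u : (Fin 3 → ℝ) → ℝ) (x : Fin 3 → ℝ) : Fin.tail (embed u x) = x := rfl

lemma tangent_zero (i : Fin 3) (x : Fin 3 → ℝ) : tangent u i x 0 = pd u i x := rfl

lemma tangent_succ (i k : Fin 3) (x : Fin 3 → ℝ) :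
    tangent u i x k.succ = if k = i then 1 else 0 := (hasPd_coord k).eq

lemma inducedMetric_apply (u : (Fin 3 → ℝ) → ℝ) (x : Fin 3 → ℝ) (i j : Fin 3) : inducedMetric u x i j =
    conf x ^ 2 * (if i = j then 1 else 0) - lapse x ^ 2 * (pd u i x * pd u j x) := by
  rw [inducedMetric, Matrix.of_apply, metricAt, metric_eq, dotProduct, Fin.sum_univ_succ]
  simp only [Matrix.mulVec_diagonal, tangent_zero, tangent_succ, metricDiag_zero, metricDiag_succ,
    tail_embed]
  by_cases h : i = j
  · subst h
    simp
    ring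
  · simp [h, Ne.symm h]
    ring

/-- The space components of the covariant derivative of the coordinate tangent fields of a graph. -/
noncomputable def spaceCov (u : (Fin 3 → ℝ) → ℝ) (x : Fin 3 → ℝ) (i j k : Fin 3) : ℝ :=
  lapse x * x k * (pd u i x * pd u j x) +
    conf x * ((if k = i then x j else 0) + (if k = j then x i else 0) -
      (if i = j then x k else 0))

lemma covDeriv_zero (hx : x ∈ ball) (i j : Fin 3) : covDeriv u x i j 0 =
    pd (pd u j) i x + conf x ^ 2 / lapse x * (x i * pd u j x + x j * pd u i x) := by
  have hl := (lapse_pos hx).ne'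
  have hp : Fin.tail (embed u x) ∈ ball := hx
  have h2 : pd (fun y => tangent u j y 0) i x = pd (pd u j) i x := rfl
  rw [covDeriv, sum_christoffel hp, h2]
  congr 1
  simp only [fun a => (hasPd_metricDiag_zero hp a).eq]
  have h0 : ∀ a, pd (metricDiag a) 0 (embed u x) = 0 := by
    intro a
    refine Fin.cases ?_ (fun k => ?_) a
    · exact (hasPd_metricDiag_zero hp 0).eq
    · exact (hasPd_metricDiag_succ hp k 0).eq
  simp only [h0, Fin.sum_univ_succ (n := 3), Fin.cons_zero, Fin.cons_succ, tangent_zero,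
    tangent_succ, metricDiag_zero, tail_embed]
  simp
  field_simp
  ring

lemma covDeriv_succ (hx : x ∈ ball) (i j k : Fin 3) :
    covDeriv u x i j k.succ = spaceCov u x i j k := by
  have hl := (conf_pos hx).ne'
  have hp : Fin.tail (embed u x) ∈ ball := hx
  have hc : pd (fun y => tangent u j y k.succ) i x = 0 := by
    simp only [tangent_succ]
    exact (hasPd_const _).eq
  rw [covDeriv, sum_christoffel hp, hc]
  simp only [fun a => (hasPd_metricDiag_succ hp k a).eq]
  rw [Fin.sum_univ_succ (fun a => pd (metricDiag a) k.succ (embed u x) * _ * _)]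
  simp only [(hasPd_metricDiag_zero hp k.succ).eq, (hasPd_metricDiag_succ hp _ k.succ).eq,
    Fin.sum_univ_succ (n := 3), Fin.cons_zero, Fin.cons_succ, tangent_zero,
    tangent_succ, metricDiag_succ, tail_embed, spaceCov]
  by_cases hij : i = j
  · subst hij
    by_cases hk : k = i
    · subst hk
      simp
      field_simp
      ring
    · simp [hk]
      field_simp
      ring
  · by_cases hk : k = i
    · subst hk
      simp [hij, Ne.symm hij]
      field_simp
      ring
    · by_cases hk' : k = j
      · subst hk'
        simp [hk, Ne.symm hk]
        field_simp
        ring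
      · simp [hk, hk', hij, Ne.symm hij]
        field_simp

end Graph

section Graph

variable {u : (Fin 3 → ℝ) → ℝ} {x : Fin 3 → ℝ}

/-- The component of the covariant derivative of the coordinate tangent fields of a graph along the
conormal `dt - du`. It is the second fundamental form without its normalising factor. -/
noncomputable def conormalCov (u : (Fin 3 → ℝ) → ℝ) (x : Fin 3 → ℝ) (i j : Fin 3) : ℝ :=
  pd (pd u j) i x + conf x ^ 2 / lapse x * (x i * pd u j x + x j * pd u i x) -
    ∑ k, spaceCov u x i j k * pd u k x

/-- The squared Euclidean norm of the differential of `u`. -/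
noncomputable def gradSq (u : (Fin 3 → ℝ) → ℝ) (x : Fin 3 → ℝ) : ℝ := ∑ i, pd u i x ^ 2

lemma metric_mulVec_inv (hx : x ∈ ball) (n : Fin 4 → ℝ) :
    metric (embed u x) *ᵥ ((metric (embed u x))⁻¹ *ᵥ n) = n := by
  have hp : Fin.tail (embed u x) ∈ ball := hx
  funext k
  rw [metric_inv hp, metric_eq, Matrix.mulVec_diagonal, Matrix.mulVec_diagonal, ← mul_assoc,
    mul_inv_cancel₀ (metricDiag_ne_zero hp k), one_mul]

lemma metricAt_gradDefining (hx : x ∈ ball) :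
    -metricAt (embed u x) (gradDefining u x) (gradDefining u x) =
      1 / lapse x ^ 2 - gradSq u x / conf x ^ 2 := by
  have hp : Fin.tail (embed u x) ∈ ball := hx
  rw [metricAt, gradDefining, metric_mulVec_inv hx, metric_inv hp, dotProduct, Fin.sum_univ_succ]
  simp only [Matrix.mulVec_diagonal, metricDiag_zero, metricDiag_succ, Fin.cons_zero, Fin.cons_succ,
    tail_embed, gradSq, Finset.sum_div]
  rw [neg_add, ← Finset.sum_neg_distrib, sub_eq_add_neg, ← Finset.sum_neg_distrib]
  congr 1
  · rw [inv_neg]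
    ring
  · exact Finset.sum_congr rfl fun i _ => by ring

lemma secondFundamentalForm_eq (hx : x ∈ ball) (i j : Fin 3) :
    secondFundamentalForm u x i j =
      1 / √(1 / lapse x ^ 2 - gradSq u x / conf x ^ 2) * conormalCov u x i j := by
  rw [secondFundamentalForm, Matrix.of_apply, normal, metricAt_gradDefining hx, metricAt,
    Matrix.mulVec_smul, gradDefining, metric_mulVec_inv hx, dotProduct_smul, dotProduct,
    Fin.sum_univ_succ, conormalCov, ← covDeriv_zero hx]
  simp only [covDeriv_succ hx, Fin.cons_zero, Fin.cons_succ, mul_neg, Finset.sum_neg_distrib,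
    smul_eq_mul]
  ring

lemma dotProduct_inducedMetric (v : Fin 3 → ℝ) :
    v ⬝ᵥ (inducedMetric u x *ᵥ v) =
      conf x ^ 2 * ∑ i, v i ^ 2 - lapse x ^ 2 * (∑ i, pd u i x * v i) ^ 2 := by
  simp only [dotProduct, Matrix.mulVec, inducedMetric_apply, Fin.sum_univ_three]
  norm_num [Fin.ext_iff]
  ring

/-- A graph is spacelike exactly where its height function has slope less than the speed of light.
-/
lemma posDef_inducedMetric_iff (hx : x ∈ ball) :
    (inducedMetric u x).PosDef ↔ lapse x ^ 2 * gradSq u x < conf x ^ 2 := by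
  have hc := pow_pos (conf_pos hx) 2
  have hl := pow_pos (lapse_pos hx) 2
  constructor
  · intro h
    by_cases h0 : (fun i => pd u i x) = 0
    · have : gradSq u x = 0 := Finset.sum_eq_zero fun i _ => by
        rw [show pd u i x = 0 from congrFun h0 i, zero_pow two_ne_zero]
      rw [this, mul_zero]
      exact hc
    · have h1 := h.dotProduct_mulVec_pos h0
      rw [star_trivial, dotProduct_inducedMetric] at h1
      have e : ∑ i, pd u i x * pd u i x = gradSq u x :=
        Finset.sum_congr rfl fun i _ => (sq _).symm
      rw [e] at h1
      change 0 < conf x ^ 2 * gradSq u x - _ at h1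
      have hg : 0 ≤ gradSq u x := Finset.sum_nonneg fun _ _ => sq_nonneg _
      by_contra! hcon
      nlinarith
  · intro h
    refine Matrix.PosDef.of_dotProduct_mulVec_pos ?_ fun v hv => ?_
    · ext i j
      rw [Matrix.conjTranspose_apply, star_trivial, inducedMetric_apply, inducedMetric_apply,
        mul_comm (pd u j x)]
      simp only [eq_comm]
    · rw [star_trivial, dotProduct_inducedMetric]
      have hv' : 0 < ∑ i, v i ^ 2 := by
        obtain ⟨k, hk⟩ := Function.ne_iff.1 hv
        exact Finset.sum_pos' (fun _ _ => sq_nonneg _) ⟨k, Finset.mem_univ k, sq_pos_of_ne_zero hk⟩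
      have hcs := Finset.sum_mul_sq_le_sq_mul_sq Finset.univ (fun i => pd u i x) v
      change _ ≤ gradSq u x * _ at hcs
      nlinarith [mul_le_mul_of_nonneg_left hcs hl.le, mul_lt_mul_of_pos_right h hv']

lemma slope_pos (hx : x ∈ ball) (h : (inducedMetric u x).PosDef) :
    0 < √(1 / lapse x ^ 2 - gradSq u x / conf x ^ 2) := by
  have hc := pow_pos (conf_pos hx) 2
  have hl := pow_pos (lapse_pos hx) 2
  have := (posDef_inducedMetric_iff hx).1 h
  refine Real.sqrt_pos.2 (sub_pos.2 ?_)
  rw [div_lt_div_iff₀ hc hl]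
  linarith

lemma secondFundamentalForm_eq_zero_iff (hx : x ∈ ball) (h : (inducedMetric u x).PosDef) :
    secondFundamentalForm u x = 0 ↔ ∀ i j, conormalCov u x i j = 0 := by
  have hs := (one_div_pos.2 (slope_pos hx h)).ne'
  rw [← Matrix.ext_iff]
  simp only [secondFundamentalForm_eq hx, Matrix.zero_apply, mul_eq_zero, hs, false_or]

lemma trace_conormalCov (hx : x ∈ ball) (h : (inducedMetric u x).PosDef)
    (hm : meanCurvature u x = 0) :
    ((inducedMetric u x)⁻¹ * Matrix.of (conormalCov u x)).trace = 0 := by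
  have hs := (one_div_pos.2 (slope_pos hx h)).ne'
  have e : secondFundamentalForm u x =
      (1 / √(1 / lapse x ^ 2 - gradSq u x / conf x ^ 2)) • Matrix.of (conormalCov u x) := by
    ext i j
    rw [secondFundamentalForm_eq hx]
    rfl
  rw [meanCurvature, e, Matrix.mul_smul, Matrix.trace_smul, smul_eq_mul] at hm
  exact (mul_eq_zero.1 hm).resolve_left hs

lemma IsTotallyGeodesic.meanCurvature_eq_zero (h : IsTotallyGeodesic u) (hx : x ∈ ball) :
    meanCurvature u x = 0 := by
  rw [meanCurvature, h x hx, mul_zero, Matrix.trace_zero]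

/-! ### Linear functions restricted to a graph -/

/-- The linear function `⟨·, a⟩` of the ambient `ℝ⁵`, restricted to the graph of `u`. -/
noncomputable def pairing (a : Fin 5 → ℝ) (u : (Fin 3 → ℝ) → ℝ) (x : Fin 3 → ℝ) : ℝ :=
  form (toQuadric (embed u x)) a

/-- The pairing of the image of `∂/∂t` with `a`. -/
noncomputable def pairingTime (a : Fin 5 → ℝ) (u : (Fin 3 → ℝ) → ℝ) (x : Fin 3 → ℝ) : ℝ :=
  lapse x * (a 3 * Real.sin (u x) - a 4 * Real.cos (u x))

/-- The space part of a vector of `ℝ⁵`. -/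
def spacePart (a : Fin 5 → ℝ) : Fin 3 → ℝ := ![a 0, a 1, a 2]

lemma pairing_eq (a : Fin 5 → ℝ) (u : (Fin 3 → ℝ) → ℝ) (x : Fin 3 → ℝ) : pairing a u x =
    conf x * ∑ i, spacePart a i * x i -
      lapse x * (a 3 * Real.cos (u x) + a 4 * Real.sin (u x)) := by
  simp only [pairing, form, toQuadric, tail_embed, Fin.sum_univ_three, conf, lapse, spacePart]
  have h1 : embed u x 1 = x 0 := rfl
  have h2 : embed u x 2 = x 1 := rfl
  have h3 : embed u x 3 = x 2 := rfl
  have h0 : embed u x 0 = u x := rfl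
  simp [h0, h1, h2, h3]
  ring

/-- The `i`-th partial derivative of `pairing a u`. -/
noncomputable def pairingDeriv (a : Fin 5 → ℝ) (u : (Fin 3 → ℝ) → ℝ) (i : Fin 3)
    (x : Fin 3 → ℝ) : ℝ :=
  conf x * spacePart a i + conf x ^ 2 * x i * ∑ k, spacePart a k * x k -
    conf x ^ 2 * x i * (a 3 * Real.cos (u x) + a 4 * Real.sin (u x)) + pairingTime a u x * pd u i x

lemma hasPd_sum_mul (c : Fin 3 → ℝ) (i : Fin 3) (x : Fin 3 → ℝ) :
    HasPd (fun y => ∑ k, c k * y k) i x (c i) := by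
  refine (HasPd.sum fun k => (hasPd_const (c k)).mul (hasPd_coord k)).congr_value ?_
  simp

lemma hasPd_pairing (a : Fin 5 → ℝ) (hx : x ∈ ball) (hu : DifferentiableAt ℝ u x) (i : Fin 3) :
    HasPd (pairing a u) i x (pairingDeriv a u i x) := by
  have hu' := hasPd_of_differentiableAt hu i
  have h := ((hasPd_conf hx i).mul (hasPd_sum_mul (spacePart a) i x)).sub
    ((hasPd_lapse hx i).mul (((hasPd_const (a 3)).mul hu'.cos).add
      ((hasPd_const (a 4)).mul hu'.sin)))
  refine HasPd.congr_of_eventuallyEq (h.congr_value ?_)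
    (Eventually.of_forall fun y => pairing_eq a u y)
  rw [pairingDeriv, pairingTime]
  ring

lemma sum_spaceCov (u : (Fin 3 → ℝ) → ℝ) (x : Fin 3 → ℝ) (i j : Fin 3) (y : Fin 3 → ℝ) :
    ∑ k, spaceCov u x i j k * y k = lapse x * (pd u i x * pd u j x) * ∑ k, x k * y k +
      conf x * (x j * y i + x i * y j - (if i = j then 1 else 0) * ∑ k, x k * y k) := by
  have h : ∀ k, spaceCov u x i j k * y k = lapse x * (pd u i x * pd u j x) * (x k * y k) +
      conf x * ((if k = i then x j * y k else 0) + (if k = j then x i * y k else 0) -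
        (if i = j then 1 else 0) * (x k * y k)) := by
    intro k
    rw [spaceCov]
    split_ifs <;> ring
  simp only [h, Finset.sum_add_distrib, Finset.sum_sub_distrib, ← Finset.mul_sum,
    Finset.sum_ite_eq', Finset.mem_univ, if_true]

/-- The Gauss formula: the position vector of a graph, seen in `ℝ⁵`, has the induced metric as its
second derivative, up to tangential terms and the second fundamental form. -/
lemma hasPd_pairingDeriv (a : Fin 5 → ℝ) (hx : x ∈ ball) (hu : ContDiffAt ℝ ∞ u x)
    (i j : Fin 3) :
    HasPd (pairingDeriv a u j) i x (∑ k, spaceCov u x i j k * pairingDeriv a u k x +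
      conormalCov u x i j * pairingTime a u x + inducedMetric u x i j * pairing a u x) := by
  have hu' := hasPd_of_differentiableAt (hu.differentiableAt (by simp)) i
  have huj := hasPd_of_differentiableAt ((contDiffAt_pd hu j).differentiableAt (by simp)) i
  have hc := hasPd_conf hx i
  have hl := hasPd_lapse hx i
  have hs := hasPd_sum_mul (spacePart a) i x
  have ht := ((hasPd_const (a 3)).mul hu'.cos).add ((hasPd_const (a 4)).mul hu'.sin)
  have ht' := hl.mul (((hasPd_const (a 3)).mul hu'.sin).sub ((hasPd_const (a 4)).mul hu'.cos))
  have hq := (hc.pow 2).mul (hasPd_coord (i := i) (p := x) j)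
  refine HasPd.congr_value ((((hc.mul (hasPd_const (spacePart a j))).add (hq.mul hs)).sub
    (hq.mul ht)).add (ht'.mul huj)) ?_
  have hr : normSq x = (lapse x - 1) / (lapse x + 1) := by
    have := (one_sub_normSq_pos hx).ne'
    rw [lapse]
    field_simp
    ring
  have hcl : conf x = lapse x + 1 := by
    rw [lapse_eq hx]
    ring
  have hl0 := lapse_pos hx
  have hl1 : lapse x + 1 ≠ 0 := by positivity
  have hxY : ∑ k, x k * pairingDeriv a u k x =
      conf x * ∑ k, spacePart a k * x k + conf x ^ 2 * normSq x * ∑ k, spacePart a k * x k -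
        conf x ^ 2 * normSq x * (a 3 * Real.cos (u x) + a 4 * Real.sin (u x)) +
        pairingTime a u x * ∑ k, x k * pd u k x := by
    simp only [pairingDeriv, normSq, Fin.sum_univ_three]
    ring
  rw [sum_spaceCov, hxY, conormalCov, sum_spaceCov, pairing_eq, inducedMetric_apply, hr,
    pairingDeriv, pairingDeriv, pairingTime, hcl]
  simp only [eq_comm (a := j) (b := i)]
  generalize (if i = j then (1 : ℝ) else 0) = δ
  generalize (∑ k, spacePart a k * x k) = s
  generalize (∑ k, x k * pd u k x) = D
  generalize lapse x = l at *
  field_simp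
  ring

end Graph

/-! ### The maximum principle -/

/-- The Hessian of a smooth function at a local maximum is negative semidefinite. -/
lemma hessian_nonpos_of_isLocalMax {n : ℕ} {f : (Fin n → ℝ) → ℝ} {p : Fin n → ℝ}
    (hf : ContDiffAt ℝ ∞ f p) (hmax : IsLocalMax f p) (v : Fin n → ℝ) :
    ∑ i, ∑ j, v i * v j * pd (pd f j) i p ≤ 0 := by
  have hline : ContinuousAt (fun s : ℝ => p + s • v) 0 := by fun_prop
  have hp0 : p + (0 : ℝ) • v = p := by simp
  have ht : Tendsto (fun s : ℝ => p + s • v) (𝓝 0) (𝓝 p) := by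
    simpa [hp0] using hline.tendsto
  have hev : ∀ᶠ q in 𝓝 p, DifferentiableAt ℝ f q := by
    filter_upwards [(hf.of_le (m := 1) (by exact_mod_cast le_top)).eventually (by simp)] with q hq
    exact hq.differentiableAt (by simp)
  have hd : deriv (fun s : ℝ => f (p + s • v)) =ᶠ[𝓝 0]
      fun s => ∑ j, v j * pd f j (p + s • v) := by
    filter_upwards [ht.eventually hev] with s hs
    exact (hasDerivAt_line p v s hs).deriv
  have hdd : deriv (deriv (fun s : ℝ => f (p + s • v))) 0 =
      ∑ i, ∑ j, v i * v j * pd (pd f j) i p := by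
    rw [hd.deriv_eq]
    have h : ∀ j, HasDerivAt (fun s : ℝ => v j * pd f j (p + s • v))
        (v j * ∑ i, v i * pd (pd f j) i p) 0 := by
      intro j
      have := hasDerivAt_line (f := pd f j) p v 0
        (by rw [hp0]; exact (contDiffAt_pd hf j).differentiableAt (by simp))
      rw [hp0] at this
      exact this.const_mul _
    rw [(HasDerivAt.fun_sum fun j _ => h j).deriv, Finset.sum_comm]
    refine Finset.sum_congr rfl fun j _ => ?_
    rw [Finset.mul_sum]
    exact Finset.sum_congr rfl fun i _ => by ring
  by_contra! hcon
  have hm : IsLocalMax (fun s : ℝ => f (p + s • v)) 0 := by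
    have := ht.eventually hmax
    filter_upwards [this] with s hs
    simpa using hs
  have hc : ContinuousAt (fun s : ℝ => f (p + s • v)) 0 := by
    refine ContinuousAt.comp (g := f) ?_ hline
    rw [hp0]
    exact hf.continuousAt
  have hmin := isLocalMin_of_deriv_deriv_pos (by rw [hdd]; exact hcon) hm.deriv_eq_zero hc
  -- A point that is both a local maximum and a local minimum makes the function locally constant.
  have hconst : (fun s : ℝ => f (p + s • v)) =ᶠ[𝓝 0] fun _ => f (p + (0 : ℝ) • v) := by
    filter_upwards [hm, hmin] with s h1 h2 using le_antisymm h1 h2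
  have h0 : deriv (deriv (fun s : ℝ => f (p + s • v))) 0 = 0 := by
    rw [hconst.deriv.deriv_eq]
    simp
  rw [hdd] at h0
  exact hcon.ne' h0

open scoped MatrixOrder in
/-- The trace of a negative semidefinite form with respect to an inner product is nonpositive. -/
lemma trace_inv_mul_nonpos {n : ℕ} {g H : Matrix (Fin n) (Fin n) ℝ} (hg : g.PosDef)
    (hH : ∀ v : Fin n → ℝ, ∑ i, ∑ j, v i * v j * H i j ≤ 0) : (g⁻¹ * H).trace ≤ 0 := by
  obtain ⟨C, hC⟩ := CStarAlgebra.nonneg_iff_eq_star_mul_self.1 hg.inv.posSemidef.nonneg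
  rw [hC, Matrix.mul_assoc, Matrix.trace_mul_comm]
  refine Finset.sum_nonpos fun k _ => ?_
  refine le_trans (le_of_eq ?_) (hH (C k))
  simp only [Matrix.diag_apply, Matrix.mul_apply, Matrix.star_apply, star_trivial, Finset.sum_mul]
  rw [Finset.sum_comm]
  exact Finset.sum_congr rfl fun i _ => Finset.sum_congr rfl fun j _ => by ring

variable {u w : (Fin 3 → ℝ) → ℝ}

lemma IsSlice.contDiffAt (hu : IsSlice u) {x : Fin 3 → ℝ} (hx : x ∈ ball) : ContDiffAt ℝ ∞ u x :=
  hu.smooth.contDiffAt (isOpen_ball.mem_nhds hx)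

lemma contDiffAt_conf {x : Fin 3 → ℝ} (hx : x ∈ ball) : ContDiffAt ℝ ∞ conf x :=
  contDiffAt_const.div (contDiffAt_const.sub contDiff_normSq.contDiffAt)
    (one_sub_normSq_pos hx).ne'

lemma contDiffAt_lapse {x : Fin 3 → ℝ} (hx : x ∈ ball) : ContDiffAt ℝ ∞ lapse x :=
  (contDiffAt_const.add contDiff_normSq.contDiffAt).div
    (contDiffAt_const.sub contDiff_normSq.contDiffAt) (one_sub_normSq_pos hx).ne'

lemma contDiffAt_pairing (a : Fin 5 → ℝ) {x : Fin 3 → ℝ} (hx : x ∈ ball)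
    (hu : ContDiffAt ℝ ∞ u x) : ContDiffAt ℝ ∞ (pairing a u) x := by
  have hc := contDiffAt_conf hx
  have hl := contDiffAt_lapse hx
  rw [show pairing a u = _ from funext (pairing_eq a u)]
  have hs : ContDiffAt ℝ ∞ (fun y : Fin 3 → ℝ => ∑ i, spacePart a i * y i) x := by fun_prop
  exact (hc.mul hs).sub (hl.mul ((contDiffAt_const.mul hu.cos).add (contDiffAt_const.mul hu.sin)))

/-- On a maximal slice, `pairing a u` satisfies `Δ f = 3 f`, so it has no positive local maximum. -/
lemma pairing_nonpos_of_isLocalMax (hu : IsMaximalSlice u) (a : Fin 5 → ℝ) {x : Fin 3 → ℝ}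
    (hx : x ∈ ball) (hmax : IsLocalMax (pairing a u) x) : pairing a u x ≤ 0 := by
  have hux := hu.contDiffAt hx
  have hg := hu.spacelike x hx
  have hP := fun i => (hasPd_pairing a hx (hux.differentiableAt (by simp)) i).eq
  have hcrit : ∀ i, pairingDeriv a u i x = 0 := by
    intro i
    rw [← hP i, pd, hmax.fderiv_eq_zero]
    rfl
  have hev : ∀ i, pd (pairing a u) i =ᶠ[𝓝 x] pairingDeriv a u i := by
    intro i
    filter_upwards [isOpen_ball.mem_nhds hx] with y hy
    exact (hasPd_pairing a hy ((hu.contDiffAt hy).differentiableAt (by simp)) i).eq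
  have hH : ∀ i j, pd (pd (pairing a u) j) i x =
      (pairingTime a u x • Matrix.of (conormalCov u x) +
        pairing a u x • inducedMetric u x) i j := by
    intro i j
    rw [pd_congr (hev j), (hasPd_pairingDeriv a hx hux i j).eq]
    simp only [hcrit, mul_zero, Finset.sum_const_zero, Matrix.add_apply, Matrix.smul_apply,
      Matrix.of_apply, smul_eq_mul]
    ring
  have htr := trace_inv_mul_nonpos hg (fun v => by
    simpa only [hH] using hessian_nonpos_of_isLocalMax (contDiffAt_pairing a hx hux) hmax v)
  rw [Matrix.mul_add, Matrix.mul_smul, Matrix.mul_smul, Matrix.trace_add, Matrix.trace_smul,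
    Matrix.trace_smul, trace_conormalCov hx hg (hu.meanCurvature_eq_zero x hx),
    Matrix.nonsing_inv_mul _ ((Matrix.isUnit_iff_isUnit_det _).1 hg.isUnit), Matrix.trace_one] at htr
  simp at htr
  linarith

/-- The boundary values of `pairing a u`, after division by `conf`. -/
lemma tendsto_pairing_div_conf (hw : HasBoundaryValue u w) (a : Fin 5 → ℝ) {p : Fin 3 → ℝ}
    (hp : p ∈ sphere) : Tendsto (fun x => pairing a u x / conf x) (𝓝[ball] p)
      (𝓝 (∑ i, spacePart a i * p i - (a 3 * Real.cos (w p) + a 4 * Real.sin (w p)))) := by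
  have hp' : normSq p = 1 := hp
  have hu := hw p hp
  have hr : Tendsto (fun x => (1 + normSq x) / 2) (𝓝[ball] p) (𝓝 1) := by
    have : ContinuousAt (fun x => (1 + normSq x) / 2) p :=
      ((continuous_const.add contDiff_normSq.continuous).div_const 2).continuousAt
    have h := this.tendsto.mono_left (nhdsWithin_le_nhds (s := ball))
    rw [hp'] at h
    norm_num at h
    exact h
  have hs : Tendsto (fun x : Fin 3 → ℝ => ∑ i, spacePart a i * x i) (𝓝[ball] p)
      (𝓝 (∑ i, spacePart a i * p i)) := by
    have : Continuous (fun x : Fin 3 → ℝ => ∑ i, spacePart a i * x i) := by fun_prop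
    exact this.continuousAt.tendsto.mono_left nhdsWithin_le_nhds
  have ht : Tendsto (fun x => a 3 * Real.cos (u x) + a 4 * Real.sin (u x)) (𝓝[ball] p)
      (𝓝 (a 3 * Real.cos (w p) + a 4 * Real.sin (w p))) :=
    (((Real.continuous_cos.tendsto _).comp hu).const_mul _).add
      (((Real.continuous_sin.tendsto _).comp hu).const_mul _)
  have h := hs.sub (hr.mul ht)
  rw [one_mul] at h
  refine h.congr' ?_
  filter_upwards [self_mem_nhdsWithin] with x hx
  have h1 := (one_sub_normSq_pos hx).ne'
  rw [pairing_eq, conf, lapse]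
  field_simp

lemma isBounded_ball : Bornology.IsBounded ball := by
  refine (Metric.isBounded_closedBall (x := (0 : Fin 3 → ℝ)) (r := 1)).subset fun x hx => ?_
  rw [mem_closedBall_zero_iff, pi_norm_le_iff_of_nonneg zero_le_one]
  intro i
  have h1 : x i ^ 2 ≤ normSq x :=
    Finset.single_le_sum (f := fun i => x i ^ 2) (fun _ _ => sq_nonneg _) (Finset.mem_univ i)
  have h2 : normSq x < 1 := hx
  rw [Real.norm_eq_abs, ← sq_le_one_iff_abs_le_one]
  linarith

lemma mem_ball_or_mem_sphere {x : Fin 3 → ℝ} (hx : x ∈ closure ball) : x ∈ ball ∨ x ∈ sphere := by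
  have : closure ball ⊆ {x | normSq x ≤ 1} :=
    closure_minimal (fun y hy => le_of_lt (show normSq y < 1 from hy))
      (isClosed_le contDiff_normSq.continuous continuous_const)
  have h : normSq x ≤ 1 := this hx
  exact lt_or_eq_of_le h

/-- The maximum principle for linear functions on a maximal slice. -/
lemma pairing_nonpos (hu : IsMaximalSlice u) (hw : HasBoundaryValue u w) (a : Fin 5 → ℝ)
    (ha : ∀ p ∈ sphere, ∑ i, spacePart a i * p i -
      (a 3 * Real.cos (w p) + a 4 * Real.sin (w p)) < 0) {x : Fin 3 → ℝ} (hx : x ∈ ball) :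
    pairing a u x ≤ 0 := by
  by_contra! hpos
  have hcont : ∀ y ∈ ball, ContinuousAt (pairing a u) y := fun y hy =>
    (contDiffAt_pairing a hy (hu.contDiffAt hy)).continuousAt
  -- The set where the function is nonnegative stays away from the sphere, so it is compact.
  have hclosed : IsClosed (ball ∩ {y | 0 ≤ pairing a u y}) := by
    refine isClosed_of_closure_subset fun p hp => ?_
    rcases mem_ball_or_mem_sphere (closure_mono Set.inter_subset_left hp) with hb | hs
    · refine ⟨hb, ?_⟩
      by_contra! hneg
      replace hneg : pairing a u p < 0 := not_le.1 hneg
      have := (hcont p hb).eventually (gt_mem_nhds hneg)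
      obtain ⟨y, hy1, hy2⟩ := (mem_closure_iff_frequently.1 hp).and_eventually this |>.exists
      exact (not_lt.2 hy1.2) hy2
    · exfalso
      have h1 := (tendsto_pairing_div_conf hw a hs).eventually (gt_mem_nhds (ha p hs))
      rw [eventually_nhdsWithin_iff] at h1
      obtain ⟨y, hy1, hy2⟩ := (mem_closure_iff_frequently.1 hp).and_eventually h1 |>.exists
      exact (not_lt.2 (div_nonneg hy1.2 (conf_pos hy1.1).le)) (hy2 hy1.1)
  have hcomp : IsCompact (ball ∩ {y | 0 ≤ pairing a u y}) :=
    Metric.isCompact_of_isClosed_isBounded hclosed (isBounded_ball.subset Set.inter_subset_left)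
  obtain ⟨y, hy, hmax⟩ := hcomp.exists_isMaxOn ⟨x, hx, hpos.le⟩
    (fun z hz => (hcont z hz.1).continuousWithinAt)
  have hypos : 0 < pairing a u y := hpos.trans_le (hmax ⟨hx, hpos.le⟩)
  refine hypos.not_ge (pairing_nonpos_of_isLocalMax hu a hy.1 ?_)
  filter_upwards [isOpen_ball.mem_nhds hy.1] with z hz
  rcases le_or_gt 0 (pairing a u z) with h | h
  · exact hmax ⟨hz, h⟩
  · exact (h.trans hypos).le

/-! ### Hyperplane sections and totally geodesic slices -/

lemma form_self_neg_iff (a : Fin 5 → ℝ) :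
    form a a < 0 ↔ ∑ i, spacePart a i ^ 2 < a 3 ^ 2 + a 4 ^ 2 := by
  simp only [form, Fin.sum_univ_three, spacePart]
  simp
  constructor <;> intro h <;> linarith

lemma toQuadric_mem_quadric {p : Fin 4 → ℝ} (hp : Fin.tail p ∈ ball) :
    toQuadric p ∈ quadric := by
  have h1 := (one_sub_normSq_pos hp).ne'
  have h2 : normSq (Fin.tail p) = p 1 ^ 2 + p 2 ^ 2 + p 3 ^ 2 := by
    rw [normSq, Fin.sum_univ_three]
    rfl
  have h3 := Real.sin_sq_add_cos_sq (p 0)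
  change form (toQuadric p) (toQuadric p) = -1
  simp only [form, toQuadric]
  simp
  generalize normSq (Fin.tail p) = r at *
  field_simp
  linear_combination (-4) * h2 - (1 + r) ^ 2 * h3

/-- A timelike hyperplane section of the quadric does not meet the hyperplane in which the
projections of `X` and `a` to the timelike plane are parallel. -/
lemma cross_ne_zero {a X : Fin 5 → ℝ} (ha : form a a < 0) (hX : X ∈ quadric)
    (hXa : form X a = 0) : X 3 * a 4 - X 4 * a 3 ≠ 0 := by
  intro h
  have hX' : form X X = -1 := hX
  have hcs := Finset.sum_mul_sq_le_sq_mul_sq Finset.univ (spacePart X) (spacePart a)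
  rw [form_self_neg_iff] at ha
  simp only [form, Fin.sum_univ_three, spacePart] at *
  simp at hcs ha
  -- Lagrange's identity in the timelike plane, combined with Cauchy-Schwarz in the space part.
  have h1 : (X 0 * a 0 + X 1 * a 1 + X 2 * a 2) ^ 2 =
      (X 3 ^ 2 + X 4 ^ 2) * (a 3 ^ 2 + a 4 ^ 2) := by
    rw [show X 0 * a 0 + X 1 * a 1 + X 2 * a 2 = X 3 * a 3 + X 4 * a 4 by linarith]
    linear_combination (-(X 3 * a 4 - X 4 * a 3)) * h
  have h2 : X 3 ^ 2 + X 4 ^ 2 = 1 + (X 0 ^ 2 + X 1 ^ 2 + X 2 ^ 2) := by linarith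
  rw [h1, h2] at hcs
  have h3 : 0 ≤ X 0 ^ 2 + X 1 ^ 2 + X 2 ^ 2 := by positivity
  have h4 : 0 ≤ a 0 ^ 2 + a 1 ^ 2 + a 2 ^ 2 := by positivity
  nlinarith [mul_le_mul_of_nonneg_left ha.le h3]

lemma toQuadric_three (u : (Fin 3 → ℝ) → ℝ) (x : Fin 3 → ℝ) :
    toQuadric (embed u x) 3 = lapse x * Real.cos (u x) := rfl

lemma toQuadric_four (u : (Fin 3 → ℝ) → ℝ) (x : Fin 3 → ℝ) :
    toQuadric (embed u x) 4 = lapse x * Real.sin (u x) := rfl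

lemma pairingTime_ne_zero {a : Fin 5 → ℝ} (ha : form a a < 0) {x : Fin 3 → ℝ} (hx : x ∈ ball)
    (h : pairing a u x = 0) : pairingTime a u x ≠ 0 := by
  have hne := cross_ne_zero ha (toQuadric_mem_quadric (p := embed u x) hx) h
  rw [toQuadric_three, toQuadric_four] at hne
  contrapose! hne
  rw [pairingTime] at hne
  linarith

lemma pairingDeriv_eq_zero {a : Fin 5 → ℝ} (h : ∀ x ∈ ball, pairing a u x = 0) {x : Fin 3 → ℝ}
    (hx : x ∈ ball) (hu : DifferentiableAt ℝ u x) (i : Fin 3) :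
    pairingDeriv a u i x = 0 := by
  rw [← (hasPd_pairing a hx hu i).eq]
  refine ((hasPd_const 0).congr_of_eventuallyEq ?_).eq
  filter_upwards [isOpen_ball.mem_nhds hx] with y hy using h y hy

/-- A slice contained in a timelike hyperplane of `ℝ⁵` is totally geodesic. -/
lemma isTotallyGeodesic_of_pairing_eq_zero (hu : IsSlice u) {a : Fin 5 → ℝ} (ha : form a a < 0)
    (h : ∀ x ∈ ball, pairing a u x = 0) : IsTotallyGeodesic u := by
  have hD : ∀ y ∈ ball, ∀ j, pairingDeriv a u j y = 0 := fun y hy =>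
    pairingDeriv_eq_zero h hy ((hu.contDiffAt hy).differentiableAt (by simp))
  intro x hx
  rw [secondFundamentalForm_eq_zero_iff hx (hu.spacelike x hx)]
  intro i j
  have h0 : pd (pairingDeriv a u j) i x = 0 := by
    refine ((hasPd_const 0).congr_of_eventuallyEq ?_).eq
    filter_upwards [isOpen_ball.mem_nhds hx] with y hy using hD y hy j
  have h1 := (hasPd_pairingDeriv a hx (hu.contDiffAt hx) i j).eq
  simp only [h0, hD x hx, h x hx, mul_zero, Finset.sum_const_zero, zero_add,
    add_zero] at h1
  exact (mul_eq_zero.1 h1.symm).resolve_right (pairingTime_ne_zero ha hx (h x hx))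

lemma continuousAt_spaceCov {x : Fin 3 → ℝ} (hx : x ∈ ball) (hu : ContDiffAt ℝ ∞ u x)
    (i j k : Fin 3) : ContinuousAt (fun y => spaceCov u y i j k) x := by
  have hd := fun i => (contDiffAt_pd hu i).continuousAt
  refine (((contDiffAt_lapse hx).continuousAt.mul (continuousAt_apply k x)).mul
    ((hd i).mul (hd j))).add ((contDiffAt_conf hx).continuousAt.mul ?_)
  have hx := fun i : Fin 3 => continuousAt_apply (A := fun _ => ℝ) i x
  refine (ContinuousAt.add ?_ ?_).sub ?_ <;> split_ifs <;>
    first | exact hx _ | exact continuousAt_const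

lemma continuousAt_inducedMetric {x : Fin 3 → ℝ} (hx : x ∈ ball) (hu : ContDiffAt ℝ ∞ u x)
    (i j : Fin 3) : ContinuousAt (fun y => inducedMetric u y i j) x := by
  have hd := fun i => (contDiffAt_pd hu i).continuousAt
  simp only [inducedMetric_apply]
  exact (((contDiffAt_conf hx).continuousAt.pow 2).mul continuousAt_const).sub
    (((contDiffAt_lapse hx).continuousAt.pow 2).mul ((hd i).mul (hd j)))

/-- On a totally geodesic slice, the Gauss formula is a linear ordinary differential equation along
each ray for the 1-jet of `pairing a u`, so the function vanishes if its 1-jet does at the centre.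
-/
lemma pairing_eq_zero_of_jet (hu : IsSlice u) (hg : IsTotallyGeodesic u) (a : Fin 5 → ℝ)
    (h0 : pairing a u 0 = 0) (h1 : ∀ i, pairingDeriv a u i 0 = 0) {x : Fin 3 → ℝ}
    (hx : x ∈ ball) : pairing a u x = 0 := by
  have hmem : ∀ s ∈ Set.Icc (0 : ℝ) 1, s • x ∈ ball := fun s hs => smul_mem_ball hx hs.1 hs.2
  let jet : ℝ → ℝ × (Fin 3 → ℝ) := fun s =>
    (pairing a u (s • x), fun j => pairingDeriv a u j (s • x))
  let jet' : ℝ → ℝ × (Fin 3 → ℝ) := fun s =>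
    (∑ i, x i * pairingDeriv a u i (s • x), fun j => ∑ i, x i *
      (∑ k, spaceCov u (s • x) i j k * pairingDeriv a u k (s • x) +
        inducedMetric u (s • x) i j * pairing a u (s • x)))
  let M : ℝ → ℝ := fun s => ∑ i, |x i| + ∑ j, ∑ i, |x i| *
    (∑ k, |spaceCov u (s • x) i j k| + |inducedMetric u (s • x) i j|)
  have hderiv : ∀ s ∈ Set.Icc (0 : ℝ) 1, HasDerivAt jet (jet' s) s := by
    intro s hs
    have hb := hmem s hs
    have hub := hu.contDiffAt hb
    refine HasDerivAt.prodMk ?_ (hasDerivAt_pi.2 fun j => ?_)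
    · have hP := hasPd_pairing a hb (hub.differentiableAt (by simp))
      have := hasDerivAt_line 0 x s (f := pairing a u) (by rw [zero_add]; exact (hP 0).1)
      simpa only [zero_add, fun i => (hP i).eq] using this
    · have hP := fun i => hasPd_pairingDeriv a hb hub i j
      have hB := (secondFundamentalForm_eq_zero_iff hb (hu.spacelike _ hb)).1 (hg _ hb)
      have := hasDerivAt_line 0 x s (f := pairingDeriv a u j) (by rw [zero_add]; exact (hP 0).1)
      simpa only [zero_add, fun i => (hP i).eq, hB, zero_mul, add_zero] using this
  have hMcont : ContinuousOn M (Set.Icc 0 1) := by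
    intro s hs
    have hb := hmem s hs
    have hub := hu.contDiffAt hb
    have hsx : ContinuousAt (fun s : ℝ => s • x) s := by fun_prop
    have hC : ∀ i j k, ContinuousAt (fun s : ℝ => spaceCov u (s • x) i j k) s := fun i j k =>
      (continuousAt_spaceCov hb hub i j k).comp (f := fun s : ℝ => s • x) hsx
    have hG : ∀ i j, ContinuousAt (fun s : ℝ => inducedMetric u (s • x) i j) s := fun i j =>
      (continuousAt_inducedMetric hb hub i j).comp (f := fun s : ℝ => s • x) hsx
    refine ContinuousAt.continuousWithinAt (continuousAt_const.add ?_)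
    refine tendsto_finsetSum _ fun j _ => tendsto_finsetSum _ fun i _ => ?_
    exact continuousAt_const.mul
      ((tendsto_finsetSum _ fun k _ => (hC i j k).abs).add (hG i j).abs)
  obtain ⟨K, hK⟩ := isCompact_Icc.bddAbove_image hMcont
  have hbound : ∀ s ∈ Set.Icc (0 : ℝ) 1, ‖jet' s‖ ≤ K * ‖jet s‖ := by
    intro s hs
    have hP : |pairing a u (s • x)| ≤ ‖jet s‖ := norm_fst_le (jet s)
    have hD : ∀ i, |pairingDeriv a u i (s • x)| ≤ ‖jet s‖ := fun i =>
      (norm_le_pi_norm (jet s).2 i).trans (norm_snd_le (jet s))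
    have hMK : M s ≤ K := hK ⟨s, hs, rfl⟩
    refine le_trans ?_ (mul_le_mul_of_nonneg_right hMK (norm_nonneg _))
    have hpos : ∀ j, 0 ≤ ∑ i, |x i| *
        (∑ k, |spaceCov u (s • x) i j k| + |inducedMetric u (s • x) i j|) := fun j => by positivity
    have hN := norm_nonneg (jet s)
    rw [Prod.norm_def, max_le_iff]
    constructor
    · change |∑ i, x i * pairingDeriv a u i (s • x)| ≤ _
      refine le_trans (Finset.abs_sum_le_sum_abs _ _) ?_
      calc ∑ i, |x i * pairingDeriv a u i (s • x)| ≤ ∑ i, |x i| * ‖jet s‖ :=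
            Finset.sum_le_sum fun i _ => by
              rw [abs_mul]
              exact mul_le_mul_of_nonneg_left (hD i) (abs_nonneg _)
        _ ≤ M s * ‖jet s‖ := by
            rw [← Finset.sum_mul]
            refine mul_le_mul_of_nonneg_right ?_ hN
            exact le_add_of_nonneg_right (Finset.sum_nonneg fun j _ => hpos j)
    · have hMs : 0 ≤ M s := add_nonneg (by positivity) (Finset.sum_nonneg fun j _ => hpos j)
      refine (pi_norm_le_iff_of_nonneg (mul_nonneg hMs hN)).2 fun j => ?_
      change |∑ i, x i * (∑ k, spaceCov u (s • x) i j k * pairingDeriv a u k (s • x) +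
        inducedMetric u (s • x) i j * pairing a u (s • x))| ≤ _
      refine le_trans (Finset.abs_sum_le_sum_abs _ _) ?_
      calc _ ≤ ∑ i, |x i| * (∑ k, |spaceCov u (s • x) i j k| + |inducedMetric u (s • x) i j|) *
              ‖jet s‖ := Finset.sum_le_sum fun i _ => by
            rw [abs_mul, mul_assoc, add_mul, Finset.sum_mul]
            refine mul_le_mul_of_nonneg_left ((abs_add_le _ _).trans (add_le_add ?_ ?_))
              (abs_nonneg _)
            · refine (Finset.abs_sum_le_sum_abs _ _).trans (Finset.sum_le_sum fun k _ => ?_)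
              rw [abs_mul]
              exact mul_le_mul_of_nonneg_left (hD k) (abs_nonneg _)
            · rw [abs_mul]
              exact mul_le_mul_of_nonneg_left hP (abs_nonneg _)
        _ ≤ M s * ‖jet s‖ := by
            rw [← Finset.sum_mul]
            refine mul_le_mul_of_nonneg_right ?_ hN
            refine le_trans (Finset.single_le_sum (f := fun j => ∑ i, |x i| *
              (∑ k, |spaceCov u (s • x) i j k| + |inducedMetric u (s • x) i j|))
              (fun j _ => hpos j) (Finset.mem_univ j)) ?_
            exact le_add_of_nonneg_left (by positivity)
  have hjet0 : jet 0 = 0 := by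
    refine Prod.ext ?_ (funext fun j => ?_)
    · change pairing a u ((0 : ℝ) • x) = 0
      rw [zero_smul, h0]
    · change pairingDeriv a u j ((0 : ℝ) • x) = 0
      rw [zero_smul, h1]
  have := eq_zero_of_abs_deriv_le_mul_abs_self_of_eq_zero_right
    (fun s hs => (hderiv s hs).continuousAt.continuousWithinAt)
    (fun s hs => (hderiv s (Set.Ico_subset_Icc_self hs)).hasDerivWithinAt) hjet0
    (fun s hs => hbound s (Set.Ico_subset_Icc_self hs)) 1 ⟨zero_le_one, le_rfl⟩
  have h := congrArg Prod.fst this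
  change pairing a u ((1 : ℝ) • x) = 0 at h
  rwa [one_smul] at h

/-- A totally geodesic slice lies in the hyperplane orthogonal to its normal vector at the centre.
-/
lemma IsTotallyGeodesic.exists_pairing_eq_zero (hg : IsTotallyGeodesic u) (hu : IsSlice u) :
    ∃ a : Fin 5 → ℝ, form a a < 0 ∧ ∀ x ∈ ball, pairing a u x = 0 := by
  have hn : normSq 0 = 0 := by simp [normSq]
  have hl : lapse 0 = 1 := by simp [lapse, hn]
  have hc : conf 0 = 2 := by simp [conf, hn]
  have hsp := (posDef_inducedMetric_iff zero_mem_ball).1 (hu.spacelike 0 zero_mem_ball)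
  rw [hl, hc, gradSq] at hsp
  have htrig := Real.sin_sq_add_cos_sq (u 0)
  -- The vector is proportional to the unit normal `(∂u, -2 sin u, 2 cos u)` at the centre.
  refine ⟨![pd u 0 0, pd u 1 0, pd u 2 0, -2 * Real.sin (u 0), 2 * Real.cos (u 0)], ?_,
    fun x hx => pairing_eq_zero_of_jet hu hg _ ?_ ?_ hx⟩
  · rw [form_self_neg_iff]
    simp only [Fin.sum_univ_three, spacePart] at hsp ⊢
    simp
    linarith
  · rw [pairing_eq, hl]
    simp
    ring
  · intro i
    rw [pairingDeriv, pairingTime, hl, hc]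
    fin_cases i
    · simp [spacePart]
      linear_combination (-2 * pd u 0 0) * htrig
    · simp [spacePart]
      linear_combination (-2 * pd u 1 0) * htrig
    · simp [spacePart]
      linear_combination (-2 * pd u 2 0) * htrig

/-! ### The boundary at infinity -/

lemma sphere_subset_closure_ball : sphere ⊆ closure ball := by
  intro p hp
  have hp' : normSq p = 1 := hp
  have ht : Tendsto (fun s : ℝ => s • p) (𝓝[<] 1) (𝓝 p) := by
    have : ContinuousAt (fun s : ℝ => s • p) 1 := by fun_prop
    simpa using this.tendsto.mono_left nhdsWithin_le_nhds
  refine mem_closure_of_tendsto ht ?_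
  filter_upwards [Ioo_mem_nhdsLT (zero_lt_one' ℝ)] with s hs
  have : normSq (s • p) = s ^ 2 * normSq p := by simp [normSq, mul_pow, Finset.mul_sum]
  change normSq (s • p) < 1
  rw [this, hp', mul_one]
  exact pow_lt_one₀ hs.1.le hs.2 two_ne_zero

lemma HasBoundaryValue.continuousOn (hw : HasBoundaryValue u w) : ContinuousOn w sphere :=
  (continuousOn_extendFrom sphere_subset_closure_ball fun p hp => ⟨w p, hw p hp⟩).congr
    fun p hp => (extendFrom_eq (sphere_subset_closure_ball hp) (hw p hp)).symm

lemma spherePoint_mem_sphere (θ φ : ℝ) : spherePoint θ φ ∈ sphere := by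
  change normSq _ = 1
  rw [normSq, Fin.sum_univ_three]
  simp only [spherePoint]
  simp
  linear_combination Real.sin θ ^ 2 * Real.sin_sq_add_cos_sq φ + Real.sin_sq_add_cos_sq θ

/-- Spherical coordinates cover the sphere. -/
lemma exists_spherePoint_eq {p : Fin 3 → ℝ} (hp : p ∈ sphere) : ∃ θ φ, spherePoint θ φ = p := by
  have hp' : p 0 ^ 2 + p 1 ^ 2 + p 2 ^ 2 = 1 := by
    have : normSq p = 1 := hp
    rwa [normSq, Fin.sum_univ_three] at this
  have h2 : -1 ≤ p 2 ∧ p 2 ≤ 1 := by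
    rw [← abs_le, ← sq_le_one_iff_abs_le_one]
    nlinarith [sq_nonneg (p 0), sq_nonneg (p 1)]
  let z : ℂ := ⟨p 0, p 1⟩
  have hz : ‖z‖ = √(1 - p 2 ^ 2) := by
    rw [Complex.norm_def, Complex.normSq_apply]
    congr 1
    change p 0 * p 0 + p 1 * p 1 = _
    linarith
  refine ⟨Real.arccos (p 2), z.arg, ?_⟩
  have e0 := Complex.norm_mul_cos_arg z
  have e1 := Complex.norm_mul_sin_arg z
  rw [hz] at e0 e1
  funext i
  fin_cases i
  · simpa [spherePoint, Real.sin_arccos] using e0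
  · simpa [spherePoint, Real.sin_arccos] using e1
  · simpa [spherePoint] using Real.cos_arccos h2.1 h2.2

lemma pos_or_neg_of_isPreconnected {X : Type*} [TopologicalSpace X] {s : Set X}
    (hs : IsPreconnected s) {f : X → ℝ} (hf : ContinuousOn f s) (h0 : ∀ x ∈ s, f x ≠ 0) :
    (∀ x ∈ s, 0 < f x) ∨ (∀ x ∈ s, f x < 0) := by
  by_contra! h
  obtain ⟨⟨x, hx, hx'⟩, ⟨y, hy, hy'⟩⟩ := h
  obtain ⟨z, hz, hz'⟩ := hs.intermediate_value hx hy hf ⟨hx', hy'⟩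
  exact h0 z hz hz'

lemma isPreconnected_sphere : IsPreconnected sphere := by
  have h : sphere = (fun q : ℝ × ℝ => spherePoint q.1 q.2) '' Set.univ := by
    ext p
    constructor
    · intro hp
      obtain ⟨θ, φ, h⟩ := exists_spherePoint_eq hp
      exact ⟨(θ, φ), trivial, h⟩
    · rintro ⟨q, -, rfl⟩
      exact spherePoint_mem_sphere _ _
  rw [h]
  refine isPreconnected_univ.image _ (Continuous.continuousOn ?_)
  refine continuous_pi fun i => ?_
  fin_cases i <;> simp [spherePoint] <;> fun_prop

lemma pairing_add_smul (a b : Fin 5 → ℝ) (t : ℝ) (x : Fin 3 → ℝ) :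
    pairing (a + t • b) u x = pairing a u x + t * pairing b u x := by
  simp only [pairing, form, Pi.add_apply, Pi.smul_apply, smul_eq_mul]
  ring

/-- The maximum principle under a weak inequality on the boundary, in the presence of a comparison
function `pairing b u` that is negative there. -/
lemma pairing_nonpos_of_le (hu : IsMaximalSlice u) (hw : HasBoundaryValue u w) (a b : Fin 5 → ℝ)
    (ha : ∀ p ∈ sphere, ∑ i, spacePart a i * p i -
      (a 3 * Real.cos (w p) + a 4 * Real.sin (w p)) ≤ 0)
    (hb : ∀ p ∈ sphere, ∑ i, spacePart b i * p i -
      (b 3 * Real.cos (w p) + b 4 * Real.sin (w p)) < 0) {x : Fin 3 → ℝ} (hx : x ∈ ball) :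
    pairing a u x ≤ 0 := by
  have hQ := pairing_nonpos hu hw b hb hx
  refine le_of_forall_pos_le_add fun ε hε => ?_
  have hd : 0 < 1 - pairing b u x := by linarith
  have ht : 0 < ε / (1 - pairing b u x) := div_pos hε hd
  have h := pairing_nonpos hu hw (a + (ε / (1 - pairing b u x)) • b) (fun p hp => by
    have h1 := ha p hp
    have h2 := mul_neg_of_pos_of_neg ht (hb p hp)
    simp only [Fin.sum_univ_three, spacePart, Pi.add_apply, Pi.smul_apply, smul_eq_mul] at *
    simp at *
    linarith) hx
  rw [pairing_add_smul] at h
  have h3 : ε / (1 - pairing b u x) * (1 - pairing b u x) = ε := div_mul_cancel₀ _ hd.ne'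
  nlinarith

/-- Uniqueness: a maximal slice with the boundary values of a hyperplane section lies in the
hyperplane. -/
lemma exists_pairing_eq_zero_of_boundary (hu : IsMaximalSlice u) (hw : HasBoundaryValue u w)
    {w₀ A B C : ℝ} (hABC : A ^ 2 + B ^ 2 + C ^ 2 < 1)
    (h : ∀ p ∈ sphere, Real.cos (w p + w₀) = A * p 0 + B * p 1 + C * p 2) :
    ∃ a : Fin 5 → ℝ, form a a < 0 ∧ ∀ x ∈ ball, pairing a u x = 0 := by
  have htrig := Real.sin_sq_add_cos_sq w₀
  have hsin : ∀ p ∈ sphere, Real.sin (w p + w₀) ≠ 0 := by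
    intro p hp h0
    have hp' : normSq p = 1 := hp
    have h1 := Real.sin_sq_add_cos_sq (w p + w₀)
    have hcs := Finset.sum_mul_sq_le_sq_mul_sq Finset.univ ![A, B, C] p
    change _ ≤ _ * normSq p at hcs
    rw [hp'] at hcs
    simp only [Fin.sum_univ_three] at hcs
    simp at hcs
    rw [← h p hp] at hcs
    rw [h0] at h1
    linarith
  obtain ⟨σ, hσ⟩ : ∃ σ : ℝ, ∀ p ∈ sphere, 0 < σ * Real.sin (w p + w₀) := by
    rcases pos_or_neg_of_isPreconnected isPreconnected_sphere
      (Real.continuous_sin.comp_continuousOn (hw.continuousOn.add continuousOn_const)) hsin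
      with hs | hs
    · exact ⟨1, fun p hp => by simpa using hs p hp⟩
    · exact ⟨-1, fun p hp => by simpa using hs p hp⟩
  -- The comparison function is `-lapse * |sin (u + w₀)|` near the sphere.
  have hb : ∀ p ∈ sphere,
      ∑ i, spacePart ![0, 0, 0, σ * Real.sin w₀, σ * Real.cos w₀] i * p i -
      ((![0, 0, 0, σ * Real.sin w₀, σ * Real.cos w₀] : Fin 5 → ℝ) 3 * Real.cos (w p) +
        (![0, 0, 0, σ * Real.sin w₀, σ * Real.cos w₀] : Fin 5 → ℝ) 4 * Real.sin (w p)) < 0 := by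
    intro p hp
    have := hσ p hp
    rw [Real.sin_add] at this
    simp [Fin.sum_univ_three, spacePart]
    linarith
  refine ⟨![A, B, C, Real.cos w₀, -Real.sin w₀], ?_, fun x hx => le_antisymm ?_ ?_⟩
  · rw [form_self_neg_iff]
    simp only [Fin.sum_univ_three, spacePart]
    simp
    linarith
  · refine pairing_nonpos_of_le hu hw _ _ (fun p hp => ?_) hb hx
    have := h p hp
    rw [Real.cos_add] at this
    simp [Fin.sum_univ_three, spacePart]
    linarith
  · have h' : pairing (0 + (-1 : ℝ) • ![A, B, C, Real.cos w₀, -Real.sin w₀]) u x ≤ 0 := by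
      refine pairing_nonpos_of_le hu hw _ _ (fun p hp => ?_) hb hx
      have := h p hp
      rw [Real.cos_add] at this
      simp [Fin.sum_univ_three, spacePart]
      linarith
    rw [pairing_add_smul] at h'
    have h0 : pairing 0 u x = 0 := by simp [pairing, form]
    linarith

/-- Polar coordinates in the timelike plane. -/
lemma exists_polar {a : Fin 5 → ℝ} (ha : form a a < 0) :
    ∃ R c : ℝ, 0 < R ∧ a 3 = R * Real.cos c ∧ a 4 = R * Real.sin c ∧
      ∑ i, spacePart a i ^ 2 < R ^ 2 := by
  rw [form_self_neg_iff] at ha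
  let z : ℂ := ⟨a 3, a 4⟩
  have hz : ‖z‖ ^ 2 = a 3 ^ 2 + a 4 ^ 2 := by
    rw [Complex.sq_norm, Complex.normSq_apply]
    change a 3 * a 3 + a 4 * a 4 = _
    ring
  have hpos : 0 < ‖z‖ := by
    refine (norm_nonneg z).lt_of_ne' fun h0 => ?_
    rw [h0, zero_pow two_ne_zero] at hz
    exact absurd (Finset.sum_nonneg fun i _ => sq_nonneg (spacePart a i)) (by linarith)
  exact ⟨‖z‖, z.arg, hpos, (Complex.norm_mul_cos_arg z).symm, (Complex.norm_mul_sin_arg z).symm,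
    hz ▸ ha⟩

/-- The boundary values of a slice contained in a timelike hyperplane. -/
lemma exists_boundary_of_pairing_eq_zero (hw : HasBoundaryValue u w) {a : Fin 5 → ℝ}
    (ha : form a a < 0) (h : ∀ x ∈ ball, pairing a u x = 0) :
    ∃ w₀ A B C : ℝ, A ^ 2 + B ^ 2 + C ^ 2 < 1 ∧
      ∀ p ∈ sphere, Real.cos (w p + w₀) = A * p 0 + B * p 1 + C * p 2 := by
  obtain ⟨R, c, hR, h3, h4, hlt⟩ := exists_polar ha
  refine ⟨-c, a 0 / R, a 1 / R, a 2 / R, ?_, fun p hp => ?_⟩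
  · simp only [Fin.sum_univ_three, spacePart] at hlt
    simp at hlt
    rw [div_pow, div_pow, div_pow, ← add_div, ← add_div, div_lt_one (pow_pos hR 2)]
    exact hlt
  · have h0 : Tendsto (fun x => pairing a u x / conf x) (𝓝[ball] p) (𝓝 0) := by
      refine tendsto_const_nhds.congr' ?_
      filter_upwards [self_mem_nhdsWithin] with x hx
      rw [h x hx, zero_div]
    have : (𝓝[ball] p).NeBot :=
      mem_closure_iff_nhdsWithin_neBot.1 (sphere_subset_closure_ball hp)
    have h1 := tendsto_nhds_unique h0 (tendsto_pairing_div_conf hw a hp)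
    rw [h3, h4] at h1
    simp only [Fin.sum_univ_three, spacePart] at h1
    simp at h1
    rw [Real.cos_add, Real.cos_neg, Real.sin_neg]
    field_simp
    linarith

/-! ### Components of hyperplane sections -/

/-- The point of the ball over which a point of the quadric lies. -/
noncomputable def spaceOf (X : Fin 5 → ℝ) : Fin 3 → ℝ :=
  fun i => spacePart X i / (1 + √(X 3 ^ 2 + X 4 ^ 2))

lemma sq_add_sq_of_mem_quadric {X : Fin 5 → ℝ} (hX : X ∈ quadric) :
    X 3 ^ 2 + X 4 ^ 2 = 1 + ∑ i, spacePart X i ^ 2 := by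
  have h : form X X = -1 := hX
  simp only [form, Fin.sum_univ_three, spacePart] at *
  simp
  linarith

lemma normSq_spaceOf {X : Fin 5 → ℝ} (hX : X ∈ quadric) :
    normSq (spaceOf X) = (√(X 3 ^ 2 + X 4 ^ 2) - 1) / (√(X 3 ^ 2 + X 4 ^ 2) + 1) := by
  have h := sq_add_sq_of_mem_quadric hX
  have hs := Real.sq_sqrt (by positivity : 0 ≤ X 3 ^ 2 + X 4 ^ 2)
  have h0 := Real.sqrt_nonneg (X 3 ^ 2 + X 4 ^ 2)
  have h1 : ∑ i, spacePart X i ^ 2 = √(X 3 ^ 2 + X 4 ^ 2) ^ 2 - 1 := by rw [hs, h]; ring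
  simp only [normSq, spaceOf, div_pow]
  rw [← Finset.sum_div, h1]
  generalize √(X 3 ^ 2 + X 4 ^ 2) = f at *
  have : 1 + f ≠ 0 := by positivity
  have : f + 1 ≠ 0 := by positivity
  field_simp
  ring

lemma spaceOf_mem_ball {X : Fin 5 → ℝ} (hX : X ∈ quadric) : spaceOf X ∈ ball := by
  change normSq _ < 1
  have h0 := Real.sqrt_nonneg (X 3 ^ 2 + X 4 ^ 2)
  rw [normSq_spaceOf hX, div_lt_one (by positivity)]
  linarith

lemma conf_spaceOf {X : Fin 5 → ℝ} (hX : X ∈ quadric) :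
    conf (spaceOf X) = 1 + √(X 3 ^ 2 + X 4 ^ 2) := by
  have h0 := Real.sqrt_nonneg (X 3 ^ 2 + X 4 ^ 2)
  rw [conf, normSq_spaceOf hX]
  generalize √(X 3 ^ 2 + X 4 ^ 2) = f at *
  have : f + 1 ≠ 0 := by positivity
  have h2 : 1 - (f - 1) / (f + 1) = 2 / (f + 1) := by
    field_simp
    ring
  rw [h2]
  field_simp
  ring

lemma lapse_spaceOf {X : Fin 5 → ℝ} (hX : X ∈ quadric) :
    lapse (spaceOf X) = √(X 3 ^ 2 + X 4 ^ 2) := by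
  rw [lapse_eq (spaceOf_mem_ball hX), conf_spaceOf hX]
  ring

/-- Two vectors of the plane of equal length with equal scalar products and cross products of the
same sign with a third one are equal. -/
lemma eq_of_dot_eq_of_cross_pos {x y x' y' c s : ℝ} (hn : x ^ 2 + y ^ 2 = x' ^ 2 + y' ^ 2)
    (hdot : x * c + y * s = x' * c + y' * s)
    (hcross : 0 < (x * s - y * c) * (x' * s - y' * c)) : x = x' ∧ y = y' := by
  have hsq : (x * s - y * c) ^ 2 = (x' * s - y' * c) ^ 2 := by
    linear_combination (c ^ 2 + s ^ 2) * hn - (x * c + y * s + x' * c + y' * s) * hdot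
  have hc : x * s - y * c = x' * s - y' * c := by
    rcases sq_eq_sq_iff_eq_or_eq_neg.1 hsq with h | h
    · exact h
    · rw [h] at hcross
      nlinarith [sq_nonneg (x' * s - y' * c)]
  have hne : c ^ 2 + s ^ 2 ≠ 0 := by
    intro h0
    have h1 : c = 0 := by nlinarith [sq_nonneg c, sq_nonneg s]
    have h2 : s = 0 := by nlinarith [sq_nonneg c, sq_nonneg s]
    simp [h1, h2] at hcross
  constructor
  · refine mul_left_cancel₀ hne ?_
    linear_combination c * hdot + s * hc
  · refine mul_left_cancel₀ hne ?_
    linear_combination s * hdot - c * hc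

/-- A point of the hyperplane section lies on the graph of `u` if it lies on the same side as the
graph. -/
lemma eq_toQuadric_of_cross_pos {a X : Fin 5 → ℝ} (hX : X ∈ quadric) (hXa : form X a = 0)
    (hu : pairing a u (spaceOf X) = 0)
    (hcross : 0 < (X 3 * a 4 - X 4 * a 3) * (Real.cos (u (spaceOf X)) * a 4 -
      Real.sin (u (spaceOf X)) * a 3)) : X = toQuadric (embed u (spaceOf X)) := by
  have hl := lapse_spaceOf hX
  have hlp := lapse_pos (spaceOf_mem_ball hX)
  have hc := conf_spaceOf hX
  have hcp := conf_pos (spaceOf_mem_ball hX)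
  have hsp : ∀ i, conf (spaceOf X) * spaceOf X i = spacePart X i := by
    intro i
    rw [hc, spaceOf]
    rw [hc] at hcp
    field_simp
  have hdot : conf (spaceOf X) * ∑ i, spacePart a i * spaceOf X i =
      ∑ i, spacePart a i * spacePart X i := by
    rw [Finset.mul_sum]
    exact Finset.sum_congr rfl fun i _ => by
      rw [← hsp]
      ring
  rw [pairing_eq, hdot] at hu
  have hform : ∑ i, spacePart a i * spacePart X i = X 3 * a 3 + X 4 * a 4 := by
    simp only [form, Fin.sum_univ_three, spacePart] at *
    simp
    linarith
  have hns : lapse (spaceOf X) ^ 2 = X 3 ^ 2 + X 4 ^ 2 := by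
    rw [hl, Real.sq_sqrt (by positivity)]
  have htrig := Real.sin_sq_add_cos_sq (u (spaceOf X))
  obtain ⟨e3, e4⟩ := eq_of_dot_eq_of_cross_pos
    (x := X 3) (y := X 4) (x' := lapse (spaceOf X) * Real.cos (u (spaceOf X)))
    (y' := lapse (spaceOf X) * Real.sin (u (spaceOf X))) (c := a 3) (s := a 4)
    (by linear_combination (-1) * hns - lapse (spaceOf X) ^ 2 * htrig) (by linarith)
    (by
      have := mul_pos hlp hcross
      linarith)
  have hs : ∀ i, spacePart (toQuadric (embed u (spaceOf X))) i = spacePart X i := by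
    intro i
    rw [← hsp, conf]
    fin_cases i <;> simp [spacePart, toQuadric, tail_embed] <;> (rw [mul_div_right_comm]; rfl)
  funext k
  fin_cases k
  · exact (hs 0).symm
  · exact (hs 1).symm
  · exact (hs 2).symm
  · exact e3
  · exact e4

lemma continuousOn_toQuadric_embed (hu : ContinuousOn u ball) :
    ContinuousOn (fun x => toQuadric (embed u x)) ball := by
  have h1 : ∀ x ∈ ball, 1 - normSq x ≠ 0 := fun x hx => (one_sub_normSq_pos hx).ne'
  have hn : ContinuousOn normSq ball := contDiff_normSq.continuous.continuousOn
  have hl : ContinuousOn lapse ball :=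
    (continuousOn_const.add hn).div (continuousOn_const.sub hn) h1
  have hx : ∀ i : Fin 3, ContinuousOn (fun x : Fin 3 → ℝ => 2 * x i / (1 - normSq x)) ball :=
    fun i => (continuousOn_const.mul (continuous_apply i).continuousOn).div
      (continuousOn_const.sub hn) h1
  refine continuousOn_pi.2 fun k => ?_
  fin_cases k
  · exact hx 0
  · exact hx 1
  · exact hx 2
  · exact hl.mul (Real.continuous_cos.comp_continuousOn hu)
  · exact hl.mul (Real.continuous_sin.comp_continuousOn hu)

/-- The image of an entire graph contained in a timelike hyperplane is a connected component of the
hyperplane section. -/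
lemma image_slice_eq_connectedComponentIn (hu : ContinuousOn u ball) {a : Fin 5 → ℝ}
    (ha : form a a < 0) (h : ∀ x ∈ ball, pairing a u x = 0) {X : Fin 5 → ℝ}
    (hX : X ∈ toQuadric '' slice u) :
    toQuadric '' slice u = connectedComponentIn (quadric ∩ hyperplane a) X := by
  have himg : toQuadric '' slice u = (fun x => toQuadric (embed u x)) '' ball :=
    Set.image_image _ _ _
  have hmem : ∀ x ∈ ball, toQuadric (embed u x) ∈ quadric ∩ hyperplane a := fun x hx =>
    ⟨toQuadric_mem_quadric (p := embed u x) hx, h x hx⟩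
  have hsub : toQuadric '' slice u ⊆ connectedComponentIn (quadric ∩ hyperplane a) X := by
    refine IsPreconnected.subset_connectedComponentIn ?_ hX ?_
    · rw [himg]
      exact isPreconnected_ball.image _ (continuousOn_toQuadric_embed hu)
    · rw [himg]
      rintro _ ⟨x, hx, rfl⟩
      exact hmem x hx
  refine hsub.antisymm fun Y hY => ?_
  have hYm := connectedComponentIn_subset _ _ hY
  have hb := spaceOf_mem_ball hYm.1
  have hZ : toQuadric (embed u (spaceOf Y)) ∈
      connectedComponentIn (quadric ∩ hyperplane a) X := hsub ⟨_, ⟨_, hb, rfl⟩, rfl⟩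
  refine ⟨_, ⟨_, hb, rfl⟩, (eq_toQuadric_of_cross_pos hYm.1 hYm.2 (h _ hb) ?_).symm⟩
  have hl := lapse_pos hb
  have hs := pos_or_neg_of_isPreconnected isPreconnected_connectedComponentIn
    (s := connectedComponentIn (quadric ∩ hyperplane a) X)
    (f := fun X : Fin 5 → ℝ => X 3 * a 4 - X 4 * a 3) (by fun_prop) (fun Z hZ => by
      have := connectedComponentIn_subset _ _ hZ
      exact cross_ne_zero ha this.1 this.2)
  have e : toQuadric (embed u (spaceOf Y)) 3 * a 4 - toQuadric (embed u (spaceOf Y)) 4 * a 3 =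
      lapse (spaceOf Y) * (Real.cos (u (spaceOf Y)) * a 4 - Real.sin (u (spaceOf Y)) * a 3) := by
    rw [toQuadric_three, toQuadric_four]
    ring
  rcases hs with hs | hs
  · have h1 := hs _ hZ
    simp only [e] at h1
    exact mul_pos (hs Y hY) (pos_of_mul_pos_right h1 hl.le)
  · have h1 := hs _ hZ
    simp only [e] at h1
    exact mul_pos_of_neg_of_neg (hs Y hY) (neg_of_mul_neg_right h1 hl.le)

/-! ### Existence of totally geodesic slices -/

/-- A graph contained in a timelike hyperplane of `ℝ⁵` is spacelike. -/
lemma posDef_inducedMetric_of_pairing_eq_zero {a : Fin 5 → ℝ} (ha : form a a < 0)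
    {x : Fin 3 → ℝ} (hx : x ∈ ball) (h : pairing a u x = 0)
    (h' : ∀ i, pairingDeriv a u i x = 0) : (inducedMetric u x).PosDef := by
  rw [posDef_inducedMetric_iff hx]
  rw [form_self_neg_iff] at ha
  have hl := lapse_pos hx
  have hc := conf_pos hx
  have htrig := Real.sin_sq_add_cos_sq (u x)
  have hr : normSq x * conf x = conf x - 2 := by
    have h1 := (one_sub_normSq_pos hx).ne'
    rw [conf]
    field_simp
    ring
  have hlc := lapse_eq hx
  rw [pairing_eq] at h
  obtain ⟨s, hs⟩ : ∃ s, s = ∑ k, spacePart a k * x k := ⟨_, rfl⟩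
  obtain ⟨t, ht⟩ : ∃ t, t = a 3 * Real.cos (u x) + a 4 * Real.sin (u x) := ⟨_, rfl⟩
  obtain ⟨m, hm⟩ : ∃ m, m = a 3 * Real.sin (u x) - a 4 * Real.cos (u x) := ⟨_, rfl⟩
  have htm : t ^ 2 + m ^ 2 = a 3 ^ 2 + a 4 ^ 2 := by
    rw [ht, hm]
    linear_combination (a 3 ^ 2 + a 4 ^ 2) * htrig
  rw [← hs, ← ht] at h
  have hst : conf x * (s - t) = -t := by
    rw [hlc] at h
    linear_combination h
  have hD : ∀ i, lapse x * m * pd u i x = -(conf x * (spacePart a i - x i * t)) := by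
    intro i
    have := h' i
    rw [pairingDeriv, pairingTime, ← hs, ← ht, ← hm] at this
    linear_combination this - conf x * x i * hst
  have hG : (lapse x * m) ^ 2 * gradSq u x =
      conf x ^ 2 * (∑ i, spacePart a i ^ 2 - 2 * t * s + normSq x * t ^ 2) := by
    have e : (lapse x * m) ^ 2 * gradSq u x = ∑ i, (lapse x * m * pd u i x) ^ 2 := by
      rw [gradSq, Finset.mul_sum]
      exact Finset.sum_congr rfl fun i _ => (mul_pow _ _ _).symm
    rw [e, hs, normSq]
    simp only [hD, Fin.sum_univ_three]
    ring
  have hG' : (lapse x * m) ^ 2 * gradSq u x = conf x ^ 2 * (∑ i, spacePart a i ^ 2 - t ^ 2) := by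
    rw [hG]
    linear_combination (-2 * conf x * t) * hst + conf x * t ^ 2 * hr
  have hg : 0 ≤ gradSq u x := Finset.sum_nonneg fun _ _ => sq_nonneg _
  have hlt : conf x ^ 2 * (∑ i, spacePart a i ^ 2 - t ^ 2) < conf x ^ 2 * m ^ 2 :=
    mul_lt_mul_of_pos_left (by linarith) (pow_pos hc 2)
  rw [← hG'] at hlt
  by_contra! hcon
  nlinarith [mul_le_mul_of_nonneg_right hcon (sq_nonneg m)]

/-- Every side of every timelike hyperplane section is the graph of a totally geodesic slice. -/
lemma exists_isMaximalSlice {a : Fin 5 → ℝ} (ha : form a a < 0) {σ : ℝ} (hσ : σ = 1 ∨ σ = -1) :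
    ∃ u : (Fin 3 → ℝ) → ℝ, IsMaximalSlice u ∧ HasBoundaryValue u u ∧ IsTotallyGeodesic u ∧
      (∀ x ∈ ball, pairing a u x = 0) ∧
      ∀ x, x ∈ ball → 0 < σ * (Real.cos (u x) * a 4 - Real.sin (u x) * a 3) := by
  obtain ⟨R, c, hR, h3, h4, hlt⟩ := exists_polar ha
  obtain ⟨y, hy⟩ : ∃ y : (Fin 3 → ℝ) → ℝ,
      y = fun x => 2 * (∑ i, spacePart a i * x i) / ((1 + normSq x) * R) := ⟨_, rfl⟩
  have hden : ∀ x, (1 + normSq x) * R ≠ 0 := fun x => (mul_pos (one_add_normSq_pos x) hR).ne'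
  have hys : ContDiff ℝ ∞ y := by
    rw [hy]
    exact ContDiff.div (by fun_prop) ((contDiff_const.add contDiff_normSq).mul contDiff_const) hden
  have hy1 : ∀ x, y x ^ 2 < 1 := by
    intro x
    have hcs := Finset.sum_mul_sq_le_sq_mul_sq Finset.univ (spacePart a) x
    change _ ≤ _ * normSq x at hcs
    have hn := normSq_nonneg x
    have hp := one_add_normSq_pos x
    rw [hy, div_pow, div_lt_one (by positivity)]
    have h1 := mul_lt_mul_of_pos_right hlt (pow_pos hp 2)
    have h2 : 0 ≤ ∑ i, spacePart a i ^ 2 := Finset.sum_nonneg fun _ _ => sq_nonneg _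
    nlinarith [mul_nonneg h2 (sq_nonneg (1 - normSq x))]
  have hya : ∀ x, -1 < y x ∧ y x < 1 := fun x => abs_lt.1 ((sq_lt_one_iff_abs_lt_one _).1 (hy1 x))
  obtain ⟨u, hu⟩ : ∃ u : (Fin 3 → ℝ) → ℝ, u = fun x => c - σ * Real.arccos (y x) := ⟨_, rfl⟩
  have hus : ContDiff ℝ ∞ u := by
    rw [hu, contDiff_iff_contDiffAt]
    intro x
    exact contDiffAt_const.sub (contDiffAt_const.mul
      ((Real.contDiffAt_arccos (hya x).1.ne' (hya x).2.ne).comp x hys.contDiffAt))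
  have hcos : ∀ x, Real.cos (c - u x) = y x := by
    intro x
    have e : c - u x = σ * Real.arccos (y x) := by rw [hu]; ring
    rw [e]
    rcases hσ with rfl | rfl
    · rw [one_mul, Real.cos_arccos (hya x).1.le (hya x).2.le]
    · rw [neg_one_mul, Real.cos_neg, Real.cos_arccos (hya x).1.le (hya x).2.le]
  have hsin : ∀ x, 0 < σ * Real.sin (c - u x) := by
    intro x
    have e : c - u x = σ * Real.arccos (y x) := by rw [hu]; ring
    have hpos : 0 < Real.sin (Real.arccos (y x)) := by
      rw [Real.sin_arccos]
      exact Real.sqrt_pos.2 (sub_pos.2 (hy1 x))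
    rw [e]
    rcases hσ with rfl | rfl
    · rwa [one_mul, one_mul]
    · rwa [neg_one_mul, neg_one_mul, Real.sin_neg, neg_neg]
  have hpair : ∀ x ∈ ball, pairing a u x = 0 := by
    intro x hx
    have h1 := (one_sub_normSq_pos hx).ne'
    have h2 := (one_add_normSq_pos x).ne'
    have h5 := hcos x
    rw [Real.cos_sub, hy] at h5
    rw [pairing_eq, h3, h4, show R * Real.cos c * Real.cos (u x) + R * Real.sin c * Real.sin (u x) =
      R * (Real.cos c * Real.cos (u x) + Real.sin c * Real.sin (u x)) by ring, h5, conf, lapse]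
    field_simp
    ring
  have hslice : IsSlice u := ⟨hus.contDiffOn, fun x hx =>
    posDef_inducedMetric_of_pairing_eq_zero ha hx (hpair x hx)
      (pairingDeriv_eq_zero hpair hx (hus.contDiffAt.differentiableAt (by simp)))⟩
  have hgeo := isTotallyGeodesic_of_pairing_eq_zero hslice ha hpair
  refine ⟨u, ⟨hslice, fun x hx => hgeo.meanCurvature_eq_zero hx⟩,
    fun p _ => hus.continuous.continuousAt.tendsto.mono_left nhdsWithin_le_nhds, hgeo, hpair,
    fun x _ => ?_⟩
  have h6 := mul_pos hR (hsin x)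
  rw [Real.sin_sub] at h6
  rw [h3, h4]
  linarith

end AdS

theorem theorem4p2 :
    (∀ u w : (Fin 3 → ℝ) → ℝ, AdS.IsMaximalSlice u → AdS.HasBoundaryValue u w →
      (AdS.IsTotallyGeodesic u ↔
        ∃ w₀ A B C : ℝ, A ^ 2 + B ^ 2 + C ^ 2 < 1 ∧
          ∀ θ φ : ℝ, Real.cos (w (AdS.spherePoint θ φ) + w₀) =
            A * (Real.sin θ * Real.cos φ) + B * (Real.sin θ * Real.sin φ) + C * Real.cos θ)) ∧
    {S : Set (Fin 5 → ℝ) | ∃ u : (Fin 3 → ℝ) → ℝ, AdS.IsMaximalSlice u ∧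
        (∃ w : (Fin 3 → ℝ) → ℝ, AdS.HasBoundaryValue u w) ∧ AdS.IsTotallyGeodesic u ∧
        S = AdS.toQuadric '' AdS.slice u} =
      {S : Set (Fin 5 → ℝ) | ∃ a : Fin 5 → ℝ, AdS.form a a < 0 ∧
        ∃ X ∈ AdS.quadric ∩ AdS.hyperplane a,
          S = connectedComponentIn (AdS.quadric ∩ AdS.hyperplane a) X} := by
  refine ⟨fun u w hu hw => ⟨fun hg => ?_, ?_⟩, Set.ext fun S => ⟨?_, ?_⟩⟩
  · obtain ⟨a, ha, h⟩ := hg.exists_pairing_eq_zero hu.toIsSlice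
    obtain ⟨w₀, A, B, C, hABC, hb⟩ := AdS.exists_boundary_of_pairing_eq_zero hw ha h
    exact ⟨w₀, A, B, C, hABC, fun θ φ => hb _ (AdS.spherePoint_mem_sphere θ φ)⟩
  · rintro ⟨w₀, A, B, C, hABC, hb⟩
    obtain ⟨a, ha, h⟩ := AdS.exists_pairing_eq_zero_of_boundary (w₀ := w₀) hu hw hABC fun p hp => by
      obtain ⟨θ, φ, rfl⟩ := AdS.exists_spherePoint_eq hp
      exact hb θ φ
    exact AdS.isTotallyGeodesic_of_pairing_eq_zero hu.toIsSlice ha h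
  · rintro ⟨u, hu, -, hg, rfl⟩
    obtain ⟨a, ha, h⟩ := hg.exists_pairing_eq_zero hu.toIsSlice
    exact ⟨a, ha, AdS.toQuadric (AdS.embed u 0),
      ⟨AdS.toQuadric_mem_quadric (p := AdS.embed u 0) AdS.zero_mem_ball, h 0 AdS.zero_mem_ball⟩,
      AdS.image_slice_eq_connectedComponentIn hu.smooth.continuousOn ha h
        ⟨_, ⟨0, AdS.zero_mem_ball, rfl⟩, rfl⟩⟩
  · rintro ⟨a, ha, X, ⟨hX, hXa⟩, rfl⟩
    have hb := AdS.spaceOf_mem_ball hX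
    have hne := AdS.cross_ne_zero ha hX hXa
    -- The slice is chosen on the side of the section on which `X` lies.
    obtain ⟨σ, hσ, hσX⟩ : ∃ σ : ℝ, (σ = 1 ∨ σ = -1) ∧ 0 < σ * (X 3 * a 4 - X 4 * a 3) := by
      rcases hne.lt_or_gt with h | h
      · exact ⟨-1, Or.inr rfl, by linarith⟩
      · exact ⟨1, Or.inl rfl, by linarith⟩
    obtain ⟨u, hu, hw, hg, h, hs⟩ := AdS.exists_isMaximalSlice ha hσ
    have hcross := mul_pos hσX (hs _ hb)
    have hσ2 : σ * σ = 1 := by rcases hσ with rfl | rfl <;> norm_num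
    rw [mul_mul_mul_comm, hσ2, one_mul] at hcross
    have hXu := AdS.eq_toQuadric_of_cross_pos hX hXa (h _ hb) hcross
    exact ⟨u, hu, ⟨u, hw⟩, hg, (AdS.image_slice_eq_connectedComponentIn hu.smooth.continuousOn ha h
      ⟨_, ⟨_, hb, rfl⟩, hXu.symm⟩).symm⟩
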